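/- Let $r$ be a positive integer and let $n$ be an integer or half-integer (i.e. $2n\in\mathbb Z$) with $n\ge (r-1)/2$. All sums over $k_1,\dots,k_r=-n,\dots,n$ below run over $k_i\in\{-n,-n+1,\dots,n\}$ (so the $k_i$ are half-integers when $n$ is). For $0<q<1$ put $$(a;q)_m=\prod_{k=1}^m(1-aq^{k-1})\ (m\ge 0),\qquad (a;q)_{-1}=\frac1{1-aq^{-1}},\qquad (a;q)_\infty=\prod_{k\ge1}(1-aq^{k-1}),$$ $$[x]_q=\frac{1-q^x}{1-q},\quad [m]_q!=\prod_{i=1}^m[i]_q,\quad \begin{bmatrix}N\\m\end{bmatrix}_q=\frac{(q^{N-m+1};q)_m}{(q;q)_m}\ (0\le m\le N),\quad \Gamma_q(x)=(1-q)^{1-x}\frac{(q;q)_\infty}{(q^x;q)_\infty}.$$ Then for every $q$ with $0<q<1$, $$\sum_{k_1,\dots,k_r=-n}^n\ \prod_{1\le i<j\le r}\bigl|[k_i-k_j]_q\bigr|\ \prod_{i=1}^r q^{(k_i+n-r+i)^2/2}\begin{bmatrix}2n\\n+k_i\end{bmatrix}_q$$ $$=\frac{r!}{[r]_{q^{1/2}}!}\prod_{i=1}^r(-q^{1/2};q^{1/2})_i\,(-q^{i/2+1};q)_{2n-r}\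 \prod_{i=1}^r\frac{\Gamma_q(1+\frac i2)}{\Gamma_q(\frac32)}\cdot\frac{\Gamma_q(2n+1)\,\Gamma_q(2n-i+\frac52)}{\Gamma_q(2n-i+2)\,\Gamma_q(2n-\frac i2+2)}.$$ Moreover, for the discrete Macdonald–Mehta integral $$\mathcal S_{r,n}(\alpha,\gamma,\delta)=\sum_{k_1,\dots,k_r=-n}^n\ \prod_{1\le i<j\le r}|k_i^\alpha-k_j^\alpha|^{2\gamma}\ \prod_{i=1}^r|k_i|^\delta\binom{2n}{n+k_i}$$ (with $|k_i|^0=1$), one has $$\mathcal S_{r,n}(1,\tfrac12,0)=\sum_{k_1,\dots,k_r=-n}^n\ \prod_{1\le i<j\le r}|k_i-k_j|\ \prod_{i=1}^r\binom{2n}{n+k_i}=2^{2rn-\binom r2}\prod_{i=1}^r\frac{\Gamma(1+\frac i2)}{\Gamma(\frac32)}\cdot\frac{\Gamma(2n+1)\,\Gamma(2n-i+\frac52)}{\Gamma(2n-i+2)\,\Gamma(2n-\frac i2+2)}.$$ -/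

import Mathlib

noncomputable section

namespace DMM

/-- The `q`-shifted factorial `(a;q)_m`, for every integer `m`:
`(a;q)_m = ∏_{k=1}^{m} (1 - a q^{k-1})` for `m ≥ 0`, and, as usual,
`(a;q)_{-m} = 1 / ∏_{k=1}^{m} (1 - a q^{-k})` for `m > 0`. -/
def qPoch (a q : ℝ) : ℤ → ℝ
  | Int.ofNat m => ∏ k ∈ Finset.range m, (1 - a * q ^ k)
  | Int.negSucc m => (∏ k ∈ Finset.range (m + 1), (1 - a / q ^ (k + 1)))⁻¹

/-- The infinite `q`-shifted factorial `(a;q)_∞` (the product converges for `|q| < 1`). -/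
def qPochInf (a q : ℝ) : ℝ := ∏' k : ℕ, (1 - a * q ^ k)

/-- The `q`-binomial coefficient `(q^{n-m+1};q)_m / (q;q)_m`, used for `0 ≤ m ≤ n`. -/
def qBinom (q : ℝ) (n m : ℕ) : ℝ := qPoch (q ^ (n - m + 1)) q m / qPoch q q m

/-- The `q`-gamma function `Γ_q(x) = (1-q)^{1-x} (q;q)_∞ / (q^x;q)_∞`. -/
def qGamma (q x : ℝ) : ℝ := (1 - q) ^ (1 - x) * (qPochInf q q / qPochInf (q ^ x) q)

/-- The `q`-number `[x]_q = (1 - q^x) / (1 - q)`. -/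
def qNum (q x : ℝ) : ℝ := (1 - q ^ x) / (1 - q)

/-- The `q`-factorial `[m]_q! = [m]_q [m-1]_q ⋯ [1]_q`. -/
def qFact (q : ℝ) (m : ℕ) : ℝ := ∏ i ∈ Finset.Icc 1 m, qNum q i

/-- The discrete Macdonald–Mehta integral
`S_{r,n}(α,γ,δ) = ∑_{k_1,…,k_r=-n}^{n} |∏_{i<j} (k_i^α - k_j^α)|^{2γ} ∏_i |k_i|^δ binom(2n, n+k_i)`
for `n` a non-negative integer or half-integer. The `k_i` run over `{-n, -n+1, …, n}`; they are
written as `k_i = κ_i - n` with `κ_i = n + k_i ∈ {0, 1, …, 2n}`. -/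
def discreteMM (r : ℕ) (n : ℝ) (α : ℕ) (γ δ : ℝ) : ℝ :=
  ∑ κ : Fin r → Fin (⌊2 * n⌋₊ + 1),
    let k : Fin r → ℝ := fun i => (κ i : ℝ) - n
    |∏ i, ∏ j ∈ Finset.Ioi i, (k i ^ α - k j ^ α)| ^ (2 * γ) *
      ∏ i, (|k i| ^ δ * (Nat.choose ⌊2 * n⌋₊ (κ i) : ℝ))

end DMM

end

/-! The sum is a disguised bounded Littlewood identity. Put `N = 2n`, `κ_i = k_i + n`, `p =
q^(1/2)`, and let the natural number `n` of the lemmas stand for `N + 1 - r`.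

Expanding the squares in the exponents makes the summand symmetric in the `κ_i`, and it vanishes on
repeated entries, so the sum is `r!` times a sum over `r`-subsets `K` of `{0, …, N}`. For `a ∈ K`
the product of `|q^a - q^b|` over all `b ≠ a` contains the denominator of the `q`-binomial
coefficient. Passing to the complement of `K` therefore removes the binomials, and after the
reflection `a ↦ N - a` what remains is the sum over `n`-subsets `L` of `∏ p^l` times the absolute
Vandermonde product of the `q^l` (`sum_subsets_qBinom`).

Up to sign, each such term is the alternant `det (x_i^(l_j))` at `x_i = p^(2i+1)`. For general `x`,
the sum of alternants over `L ⊆ {0, …, M-1}`, divided by the Vandermonde product, is a bounded sum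
of Schur functions. `sum_alternant` evaluates it by induction on `M`, with `boundedSchurSum_succ`
(Lagrange interpolation) as the recursion, and `det_boundedMatrix` rewrites the answer as one
determinant. At `x_i = p^(2i+1)` that determinant factors (`det_odd_pow_sub`), which gives the
product `qSumClosed`.

The product is matched with the stated one by recursion in `n` and, for `n = 0`, in `r`
(`qSumClosed_eq`). On the gamma side only `G (x + 1) = c x * G x`, positivity and `G 1 = 1` are used
(`prod_gamma_eq_gammaProd`), so `Γ_q` and `Γ` are treated together. The case `q = 1` is the limit `p
→ 1` from below, taken in the form that involves only `c`, so that no limit of `Γ_q` is needed. -/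

section

open Finset

/-! ### Products over pairs in a finite set. -/

/-- The product of `f x y` over all pairs `x < y` of elements of `X`. -/
def pairProd {α R : Type*} [LinearOrder α] [CommMonoid R] (f : α → α → R) (X : Finset α) : R :=
  ∏ x ∈ X, ∏ y ∈ X, if x < y then f x y else 1

section PairProd

variable {α β R : Type*} [LinearOrder α] [LinearOrder β] [CommMonoid R]

@[simp] theorem pairProd_empty (f : α → α → R) : pairProd f ∅ = 1 := by simp [pairProd]

theorem pairProd_insert {f : α → α → R} (hf : ∀ x y, f x y = f y x) {a : α} {X : Finset α}
    (ha : a ∉ X) : pairProd f (insert a X) = (∏ y ∈ X, f a y) * pairProd f X := by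
  unfold pairProd
  simp only [prod_insert ha, lt_irrefl, if_false, one_mul, prod_mul_distrib]
  rw [← mul_assoc, ← prod_mul_distrib]
  congr 1
  refine prod_congr rfl fun y hy => ?_
  rcases lt_trichotomy a y with h | h | h
  · simp [h, h.le.not_gt]
  · exact absurd (h ▸ hy) ha
  · simp [h, h.le.not_gt, hf a y]

theorem pairProd_erase {f : α → α → R} (hf : ∀ x y, f x y = f y x) {a : α} {X : Finset α}
    (ha : a ∈ X) : pairProd f X = (∏ y ∈ X.erase a, f a y) * pairProd f (X.erase a) := by
  conv_lhs => rw [← insert_erase ha]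
  exact pairProd_insert hf (notMem_erase a X)

theorem pairProd_congr {f g : α → α → R} {X : Finset α}
    (h : ∀ x ∈ X, ∀ y ∈ X, x < y → f x y = g x y) : pairProd f X = pairProd g X := by
  refine prod_congr rfl fun x hx => prod_congr rfl fun y hy => ?_
  split_ifs with hxy
  · exact h x hx y hy hxy
  · rfl

theorem pairProd_mul (f g : α → α → R) (X : Finset α) :
    pairProd (fun x y => f x y * g x y) X = pairProd f X * pairProd g X := by
  unfold pairProd
  rw [← prod_mul_distrib]
  refine prod_congr rfl fun x _ => ?_
  rw [← prod_mul_distrib]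
  refine prod_congr rfl fun y _ => ?_
  split_ifs <;> simp

theorem pairProd_image {f : β → β → R} (hf : ∀ x y, f x y = f y x) {e : α → β}
    {X : Finset α} (he : Set.InjOn e X) :
    pairProd f (X.image e) = pairProd (fun i j => f (e i) (e j)) X := by
  induction X using Finset.induction with
  | empty => simp
  | insert a X ha ih =>
    have hX : Set.InjOn e X := he.mono (by simp)
    have hmem : e a ∉ X.image e := by
      intro h
      obtain ⟨b, hb, hba⟩ := mem_image.1 h
      exact ha (he (by simp [hb]) (by simp) hba ▸ hb)
    rw [image_insert, pairProd_insert hf hmem, pairProd_insert (fun i j => hf _ _) ha, ih hX,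
      prod_image hX]

theorem pairProd_univ {n : ℕ} (f : Fin n → Fin n → R) :
    pairProd f univ = ∏ i, ∏ j ∈ Ioi i, f i j := by
  refine prod_congr rfl fun i _ => ?_
  rw [← prod_filter]
  congr 1
  ext j
  simp

/-- Each element of `X` lies in `#X - 1` pairs. -/
theorem pairProd_mul_self (g : α → R) (X : Finset α) :
    pairProd (fun x y => g x * g y) X * ∏ x ∈ X, g x = (∏ x ∈ X, g x) ^ #X := by
  induction X using Finset.induction with
  | empty => simp
  | insert a X ha ih =>
    rw [pairProd_insert (fun x y => mul_comm _ _) ha, prod_insert ha, card_insert_of_notMem ha,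
      prod_mul_distrib, prod_const]
    calc _ = g a ^ #X * g a * (∏ x ∈ X, g x) * (pairProd (fun x y => g x * g y) X * ∏ x ∈ X, g x) := by
            ac_rfl
      _ = _ := by rw [ih, mul_pow, pow_succ, pow_succ]; ac_rfl

end PairProd

theorem pairProd_const {α R : Type*} [LinearOrder α] [CommMonoid R] (c : R) (X : Finset α) :
    pairProd (fun _ _ => c) X = c ^ (#X).choose 2 := by
  induction X using Finset.induction with
  | empty => simp
  | insert a X ha ih =>
    rw [pairProd_insert (fun _ _ => rfl) ha, ih, prod_const, card_insert_of_notMem ha, ← pow_add,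
      Nat.choose_succ_succ' (#X) 1, Nat.choose_one_right]

theorem pairProd_ne_zero {α R : Type*} [LinearOrder α] [CommMonoidWithZero R] [NoZeroDivisors R]
    [Nontrivial R] {f : α → α → R} {X : Finset α}
    (h : ∀ x ∈ X, ∀ y ∈ X, x < y → f x y ≠ 0) : pairProd f X ≠ 0 := by
  refine prod_ne_zero_iff.2 fun x hx => prod_ne_zero_iff.2 fun y hy => ?_
  split_ifs with hxy
  · exact h x hx y hy hxy
  · exact one_ne_zero

/-! ### Bounded sums of Schur functions: closed form and recursion. -/

/-- A partial fraction expansion, from Lagrange interpolation at `S ∪ {-1}`. -/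
theorem sum_one_sub_mul_prod_div (S : Finset ℝ) (hS : ∀ x ∈ S, 0 < x) :
    ∑ x ∈ S, (1 - x) * ∏ y ∈ S.erase x, ((1 - x * y) / (x - y)) =
      (-1) ^ #S * (∏ x ∈ S, x - 1) := by
  classical
  have hneg : (-1 : ℝ) ∉ S := fun h => by have := hS _ h; linarith
  -- `P` has degree `#S` and there are `#S + 1` nodes, so interpolation computes its leading
  -- coefficient `∏ (-y)`. The node `-1` contributes `(-1)^#S`; at a node `x` the factor `1 - x²` of
  -- `P` loses `1 + x` to the node `-1`, leaving `1 - x`.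
  set P : Polynomial ℝ := ∏ y ∈ S, (1 - Polynomial.C y * Polynomial.X) with hP
  have hfac : ∀ y ∈ S, (1 - Polynomial.C y * Polynomial.X : Polynomial ℝ).natDegree = 1 := by
    intro y hy
    have : (1 - Polynomial.C y * Polynomial.X : Polynomial ℝ) =
      Polynomial.C (-y) * Polynomial.X + Polynomial.C 1 := by simp; ring
    rw [this, Polynomial.natDegree_linear (by have := hS y hy; linarith)]
  have hfac0 : ∀ y ∈ S, (1 - Polynomial.C y * Polynomial.X : Polynomial ℝ) ≠ 0 := by
    intro y hy h
    have := hfac y hy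
    rw [h] at this; simp at this
  have hlc : ∀ y ∈ S, (1 - Polynomial.C y * Polynomial.X : Polynomial ℝ).leadingCoeff = -y := by
    intro y hy
    have : (1 - Polynomial.C y * Polynomial.X : Polynomial ℝ) =
      Polynomial.C (-y) * Polynomial.X + Polynomial.C 1 := by simp; ring
    rw [this, Polynomial.leadingCoeff_linear (by have := hS y hy; linarith)]
  have hdeg : P.natDegree = #S := by
    rw [hP, Polynomial.natDegree_prod _ _ hfac0, sum_congr rfl hfac]; simp
  have hcoeff : P.coeff (#S) = ∏ y ∈ S, (-y) := by
    rw [← hdeg, Polynomial.coeff_natDegree, hP, Polynomial.leadingCoeff_prod]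
    exact prod_congr rfl hlc
  have hlt : P.degree < #(insert (-1) S) := by
    rw [card_insert_of_notMem hneg]
    refine lt_of_le_of_lt Polynomial.degree_le_natDegree ?_
    rw [hdeg]; exact_mod_cast Nat.lt_succ_self _
  have key := Lagrange.coeff_eq_sum (s := insert (-1 : ℝ) S) (v := id) Function.injective_id.injOn hlt
  rw [card_insert_of_notMem hneg, Nat.add_sub_cancel, hcoeff, sum_insert hneg,
    erase_insert hneg] at key
  have h1 : Polynomial.eval (id (-1)) P / ∏ j ∈ S, ((id (-1 : ℝ)) - id j) = (-1) ^ #S := by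
    rw [hP, Polynomial.eval_prod, ← prod_div_distrib]
    rw [← prod_const]
    refine prod_congr rfl fun y hy => ?_
    have := hS y hy
    simp only [id, Polynomial.eval_sub, Polynomial.eval_one, Polynomial.eval_mul,
      Polynomial.eval_C, Polynomial.eval_X]
    rw [div_eq_iff (by linarith)]; ring
  have h2 : ∀ x ∈ S, Polynomial.eval (id x) P / ∏ j ∈ (insert (-1) S).erase x, (id x - id j) =
      (1 - x) * ∏ y ∈ S.erase x, ((1 - x * y) / (x - y)) := by
    intro x hx
    have hx0 := hS x hx
    have hne : x ≠ -1 := by linarith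
    rw [erase_insert_of_ne hne.symm, prod_insert (by simp [hneg]), hP, Polynomial.eval_prod,
      ← mul_prod_erase _ _ hx, prod_div_distrib]
    simp only [id, Polynomial.eval_sub, Polynomial.eval_one, Polynomial.eval_mul,
      Polynomial.eval_C, Polynomial.eval_X]
    have e1 : x - -1 ≠ 0 := by linarith
    rw [prod_congr rfl (fun y _ => by rw [mul_comm y x] : ∀ y ∈ S.erase x, 1 - y * x = 1 - x * y)]
    rw [mul_div_mul_comm]
    congr 1
    rw [div_eq_iff e1]; ring
  rw [h1, sum_congr rfl h2] at key
  have h3 : ∏ y ∈ S, (-y) = (-1) ^ #S * ∏ y ∈ S, y := by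
    rw [← prod_const, ← prod_mul_distrib]; simp
  rw [h3] at key
  linarith

/-- The one-variable factors of `boundedCoeff`. -/
noncomputable def siteWeight (S : Finset ℝ) (x : ℝ) : ℝ :=
  if x ∈ S then -(1 - x)⁻¹ else (1 - x)⁻¹

/-- The two-variable factors of `boundedCoeff`. -/
noncomputable def pairWeight (S : Finset ℝ) (x y : ℝ) : ℝ :=
  if x ∈ S then if y ∈ S then -(1 - x * y)⁻¹ else (x - y)⁻¹
  else if y ∈ S then (y - x)⁻¹ else (1 - x * y)⁻¹

theorem pairWeight_comm (S : Finset ℝ) (x y : ℝ) : pairWeight S x y = pairWeight S y x := by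
  unfold pairWeight
  rw [mul_comm x y]
  split_ifs <;> rfl

/-- The coefficient of `∏ x ∈ S, x ^ M` in `boundedSchurSum M X`. -/
noncomputable def boundedCoeff (S X : Finset ℝ) : ℝ :=
  (∏ x ∈ X, siteWeight S x) * pairProd (pairWeight S) X

/-- Closed form of the sum of the Schur functions in the variables `X` over all partitions with
parts at most `M - #X`. -/
noncomputable def boundedSchurSum (M : ℕ) (X : Finset ℝ) : ℝ :=
  ∑ S ∈ X.powerset, boundedCoeff S X * ∏ x ∈ S, x ^ M

theorem boundedCoeff_erase {S X : Finset ℝ} (hSX : S ⊆ X) {x : ℝ} (hx : x ∈ S) :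
    boundedCoeff S X = (siteWeight S x * ∏ y ∈ X.erase x, pairWeight S x y) *
      boundedCoeff (S.erase x) (X.erase x) := by
  unfold boundedCoeff
  rw [← mul_prod_erase _ _ (hSX hx), pairProd_erase (pairWeight_comm S) (hSX hx)]
  have h1 : ∏ y ∈ X.erase x, siteWeight (S.erase x) y = ∏ y ∈ X.erase x, siteWeight S y := by
    refine prod_congr rfl fun y hy => ?_
    simp [siteWeight, (mem_erase.1 hy).1]
  have h2 : pairProd (pairWeight (S.erase x)) (X.erase x) = pairProd (pairWeight S) (X.erase x) := by
    refine pairProd_congr fun y hy z hz _ => ?_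
    simp [pairWeight, (mem_erase.1 hy).1, (mem_erase.1 hz).1]
  rw [h1, h2]
  ring

/-- Puts the coefficients occurring in the recursion in the shape of the summands of
`sum_one_sub_mul_prod_div`: pairs of `x` with elements outside `S` cancel against the denominator,
and only pairs inside `S` survive. -/
theorem boundedCoeff_erase_div {S X : Finset ℝ} (hX : ∀ x ∈ X, 0 < x ∧ x < 1) (hSX : S ⊆ X) {x : ℝ}
    (hx : x ∈ S) : boundedCoeff (S.erase x) (X.erase x) / ∏ y ∈ X.erase x, (x - y) =
      boundedCoeff S X * (-1) ^ #S * ((1 - x) * ∏ y ∈ S.erase x, ((1 - x * y) / (x - y))) := by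
  have hsub : ∀ y ∈ X.erase x, x - y ≠ 0 := fun y hy => sub_ne_zero.2 (mem_erase.1 hy).1.symm
  have hmul : ∀ y ∈ X, 1 - x * y ≠ 0 := by
    intro y hy
    have h1 := hX x (hSX hx); have h2 := hX y hy
    nlinarith
  have hx1 : 1 - x ≠ 0 := by have := hX x (hSX hx); linarith
  have hD : ∏ y ∈ X.erase x, (x - y) ≠ 0 := prod_ne_zero_iff.2 hsub
  have hP : ∏ y ∈ S.erase x, ((1 - x * y) / (x - y)) ≠ 0 :=
    prod_ne_zero_iff.2 fun y hy => div_ne_zero (hmul y (hSX (mem_erase.1 hy).2))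
      (hsub y (erase_subset_erase _ hSX hy))
  have key : (∏ y ∈ X.erase x, pairWeight S x y) * ∏ y ∈ X.erase x, (x - y) =
      (-1) ^ (#S - 1) * (∏ y ∈ S.erase x, ((1 - x * y) / (x - y)))⁻¹ := by
    rw [← prod_mul_distrib, ← prod_inv_distrib, ← card_erase_of_mem hx, ← prod_const,
      ← prod_mul_distrib]
    symm
    refine prod_subset_one_on_sdiff (erase_subset_erase _ hSX) ?_ ?_
    · intro y hy
      have hy1 := (mem_sdiff.1 hy).1
      have hy2 : y ∉ S := fun h => (mem_sdiff.1 hy).2 (mem_erase.2 ⟨(mem_erase.1 hy1).1, h⟩)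
      simp only [pairWeight, hx, hy2, if_true, if_false]
      exact inv_mul_cancel₀ (hsub y hy1)
    · intro y hy
      have := hmul y (hSX (mem_erase.1 hy).2)
      have := hsub y (erase_subset_erase _ hSX hy)
      simp only [pairWeight, hx, (mem_erase.1 hy).2, if_true]
      field_simp
  have hs : #S - 1 + 1 = #S := Nat.sub_add_cancel (card_pos.2 ⟨x, hx⟩)
  have hsq : ((-1 : ℝ) ^ (#S - 1)) ^ 2 = 1 := by rw [← pow_mul, mul_comm, pow_mul]; simp
  rw [boundedCoeff_erase hSX hx, div_eq_iff hD]
  have e : siteWeight S x = -(1 - x)⁻¹ := by simp [siteWeight, hx]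
  rw [e]
  generalize ∏ y ∈ X.erase x, pairWeight S x y = A at *
  generalize ∏ y ∈ S.erase x, ((1 - x * y) / (x - y)) = B at *
  generalize ∏ y ∈ X.erase x, (x - y) = D at *
  rw [← hs, pow_succ]
  generalize (-1 : ℝ) ^ (#S - 1) = s at *
  have : -(1 - x)⁻¹ * A * boundedCoeff (S.erase x) (X.erase x) * (s * -1) * ((1 - x) * B) * D =
    ((1 - x)⁻¹ * (1 - x)) * boundedCoeff (S.erase x) (X.erase x) * s * B * (A * D) := by ring
  rw [this, key, inv_mul_cancel₀ hx1]
  have : 1 * boundedCoeff (S.erase x) (X.erase x) * s * B * (s * B⁻¹) =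
    boundedCoeff (S.erase x) (X.erase x) * s ^ 2 * (B * B⁻¹) := by ring
  rw [this, hsq, mul_inv_cancel₀ hP]
  ring

/-- Compare the coefficients of `∏ x ∈ S, x ^ M`: the difference of the two bounded sums contributes
the factor `∏ x - 1`, which is what `sum_one_sub_mul_prod_div` produces from the sum over `x ∈ S`.
The recursion has the same form as the expansion of alternants in `alternant_insert`. -/
theorem boundedSchurSum_succ (M : ℕ) (X : Finset ℝ) (hX : ∀ x ∈ X, 0 < x ∧ x < 1) :
    boundedSchurSum (M + 1) X = boundedSchurSum M X +
      ∑ x ∈ X, x ^ M * boundedSchurSum M (X.erase x) / ∏ y ∈ X.erase x, (x - y) := by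
  have key : ∑ x ∈ X, x ^ M * boundedSchurSum M (X.erase x) / ∏ y ∈ X.erase x, (x - y) =
      ∑ S ∈ X.powerset, ∑ x ∈ S, boundedCoeff (S.erase x) (X.erase x) /
        (∏ y ∈ X.erase x, (x - y)) * ∏ y ∈ S, y ^ M := by
    unfold boundedSchurSum
    simp_rw [mul_sum, sum_div]
    rw [sum_sigma', sum_sigma']
    -- A subset of `X.erase x` together with `x` is the same as a subset of `X` with a marked
    -- element `x`.
    refine sum_bij' (fun a _ => ⟨insert a.1 a.2, a.1⟩) (fun a _ => ⟨a.2, a.1.erase a.2⟩) ?_ ?_ ?_ ?_ ?_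
    · rintro ⟨x, S⟩ h
      simp only [mem_sigma, mem_powerset] at h ⊢
      exact ⟨insert_subset h.1 (h.2.trans (erase_subset _ _)), mem_insert_self _ _⟩
    · rintro ⟨S, x⟩ h
      simp only [mem_sigma, mem_powerset] at h ⊢
      exact ⟨h.1 h.2, erase_subset_erase _ h.1⟩
    · rintro ⟨x, S⟩ h
      simp only [mem_sigma, mem_powerset] at h
      have : x ∉ S := fun hx => (mem_erase.1 (h.2 hx)).1 rfl
      simp [erase_insert this]
    · rintro ⟨S, x⟩ h
      simp only [mem_sigma, mem_powerset] at h
      simp [insert_erase h.2]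
    · rintro ⟨x, S⟩ h
      simp only [mem_sigma, mem_powerset] at h
      have : x ∉ S := fun hx => (mem_erase.1 (h.2 hx)).1 rfl
      simp only [erase_insert this, prod_insert this]
      ring
  rw [key]
  unfold boundedSchurSum
  rw [← sum_add_distrib]
  refine sum_congr rfl fun S hS => ?_
  have hSX := mem_powerset.1 hS
  rw [← sum_mul, sum_congr rfl fun x hx => boundedCoeff_erase_div hX hSX hx, ← mul_sum,
    sum_one_sub_mul_prod_div S fun x hx => (hX x (hSX hx)).1]
  have hsq : ((-1 : ℝ) ^ #S) * (-1) ^ #S = 1 := by rw [← mul_pow]; simp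
  rw [show boundedCoeff S X * (-1) ^ #S * ((-1) ^ #S * (∏ x ∈ S, x - 1)) =
    boundedCoeff S X * ((-1) ^ #S * (-1) ^ #S) * (∏ x ∈ S, x - 1) by ring, hsq]
  simp only [pow_succ, prod_mul_distrib]
  ring

/-! ### The determinant form of the bounded sum. -/

theorem det_vandermonde_eq_pairProd {n : ℕ} (x : Fin n → ℝ) :
    (Matrix.vandermonde x).det = pairProd (fun i j => x j - x i) univ := by
  rw [Matrix.det_vandermonde, pairProd_univ]

theorem pairProd_mul_eq_pow {n : ℕ} (u : Fin (n + 1) → ℝ) (hu : ∀ i, u i ≠ 0) :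
    pairProd (fun i j => u i * u j) univ = ∏ i, u i ^ n := by
  have h := pairProd_mul_self u univ
  have h0 : ∏ i, u i ≠ 0 := prod_ne_zero_iff.2 fun i _ => hu i
  rw [card_univ, Fintype.card_fin, pow_succ] at h
  rw [prod_pow]
  exact mul_right_cancel₀ h0 h

/-- The numerator of the bounded Littlewood identity. -/
noncomputable def boundedMatrix {n : ℕ} (M : ℕ) (x : Fin n → ℝ) : Matrix (Fin n) (Fin n) ℝ :=
  Matrix.of fun i j => x i ^ (j : ℕ) - x i ^ (M + n - 1 - j)

/-- Multilinearity in the rows. Since `x^(M+n-j) = x^(M+n) * (x⁻¹)^j`, choosing the second term in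
the rows of `s` leaves a Vandermonde determinant with those variables inverted. -/
theorem det_boundedMatrix_expand {n : ℕ} (M : ℕ) (x : Fin (n + 1) → ℝ) (hx : ∀ i, x i ≠ 0) :
    (boundedMatrix M x).det = ∑ s : Finset (Fin (n + 1)),
      (∏ i, if i ∈ s then -x i ^ (M + n) else 1) *
        pairProd (fun i j => (if j ∈ s then (x j)⁻¹ else x j) - if i ∈ s then (x i)⁻¹ else x i)
          univ := by
  have h1 : boundedMatrix M x =
      (fun i j => -x i ^ (M + n - j) : Fin (n + 1) → Fin (n + 1) → ℝ) +
        (fun i j => x i ^ (j : ℕ) : Fin (n + 1) → Fin (n + 1) → ℝ) := by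
    ext i j
    simp only [boundedMatrix, Matrix.of_apply, Pi.add_apply]
    rw [show M + (n + 1) - 1 - (j : ℕ) = M + n - j by omega]
    ring
  have h2 := (Matrix.detRowAlternating (R := ℝ) (n := Fin (n + 1))).map_add_univ
    (fun i j => -x i ^ (M + n - j) : Fin (n + 1) → Fin (n + 1) → ℝ)
    (fun i j => x i ^ (j : ℕ) : Fin (n + 1) → Fin (n + 1) → ℝ)
  rw [← h1] at h2
  refine Eq.trans h2 (sum_congr rfl fun s _ => ?_)
  rw [← det_vandermonde_eq_pairProd fun i => if i ∈ s then (x i)⁻¹ else x i,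
    ← Matrix.det_mul_column]
  refine congrArg Matrix.det ?_
  ext i j
  by_cases hi : i ∈ s
  · have hj : (j : ℕ) ≤ M + n := by have := j.2; omega
    simp only [hi, Finset.piecewise_eq_of_mem, Matrix.of_apply, if_true, Matrix.vandermonde_apply]
    rw [pow_sub₀ _ (hx i) hj, inv_pow]
    ring
  · simp [hi, Matrix.vandermonde_apply]

/-- The row subset `s` in `det_boundedMatrix_expand` gives the term of `boundedSchurSum` at the
image of `s`. Clearing the inverses costs each inverted variable a power equal to the number of the
other variables, turning its exponent into `M`. -/
theorem det_boundedMatrix {n : ℕ} (M : ℕ) (x : Fin n → ℝ) (hx : ∀ i, 0 < x i ∧ x i < 1)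
    (hinj : Function.Injective x) :
    (boundedMatrix M x).det = pairProd (fun i j => x j - x i) univ *
      ((∏ i, (1 - x i)) * pairProd (fun i j => 1 - x i * x j) univ) *
        boundedSchurSum M (univ.image x) := by
  obtain _ | n := n
  · simp [boundedSchurSum, boundedCoeff]
  rw [det_boundedMatrix_expand M x fun i => (hx i).1.ne']
  have hpow : (univ.image x).powerset = (univ : Finset (Finset (Fin (n + 1)))).image (image x) := by
    ext S
    simp only [mem_powerset, mem_image, mem_univ, true_and]
    rw [subset_image_iff]
    simp
  unfold boundedSchurSum
  rw [hpow, sum_image (Finset.image_injective hinj).injOn, mul_sum]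
  refine sum_congr rfl fun s _ => ?_
  have hmem : ∀ i, x i ∈ s.image x ↔ i ∈ s := fun i => by simp [hinj.eq_iff]
  have hu : ∀ i, (if i ∈ s then x i else 1) ≠ 0 := by
    intro i; split_ifs
    · exact (hx i).1.ne'
    · exact one_ne_zero
  have hsite : (∏ i, if i ∈ s then -x i ^ (M + n) else (1 : ℝ)) =
      ((∏ i, (1 - x i)) * (∏ i, siteWeight (s.image x) (x i)) * ∏ y ∈ s.image x, y ^ M) *
        pairProd (fun i j => (if i ∈ s then x i else 1) * if j ∈ s then x j else 1) univ := by
    rw [pairProd_mul_eq_pow _ hu, prod_image hinj.injOn, ← prod_ite_mem_eq (s := s) (f := fun i => x i ^ M)]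
    simp only [← prod_mul_distrib]
    refine prod_congr rfl fun i _ => ?_
    have : 1 - x i ≠ 0 := by have := hx i; linarith
    simp only [siteWeight, hmem]
    split_ifs
    · field_simp; ring
    · field_simp; simp
  have hpair : pairProd (fun i j => (if i ∈ s then x i else 1) * if j ∈ s then x j else 1) univ *
      pairProd (fun i j => (if j ∈ s then (x j)⁻¹ else x j) - if i ∈ s then (x i)⁻¹ else x i) univ =
      pairProd (fun i j => x j - x i) univ * pairProd (fun i j => 1 - x i * x j) univ *
        pairProd (pairWeight (s.image x)) (univ.image x) := by
    rw [pairProd_image (pairWeight_comm _) hinj.injOn]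
    simp only [← pairProd_mul]
    refine pairProd_congr fun i _ j _ hij => ?_
    have h1 : 1 - x i * x j ≠ 0 := by
      have := hx i; have := hx j; nlinarith
    have h2 : x i - x j ≠ 0 := sub_ne_zero.2 fun h => hij.ne (hinj h)
    have h3 : x j - x i ≠ 0 := sub_ne_zero.2 fun h => hij.ne' (hinj h)
    have h4 := (hx i).1.ne'
    have h5 := (hx j).1.ne'
    simp only [pairWeight, hmem]
    by_cases hi : i ∈ s <;> by_cases hj : j ∈ s <;> simp only [hi, hj, if_true, if_false]
    · field_simp; ring
    · field_simp; ring
    · field_simp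
    · rw [mul_assoc, mul_assoc, mul_inv_cancel₀ h1]; ring
  unfold boundedCoeff
  rw [hsite, mul_assoc, hpair, prod_image (s := univ) hinj.injOn]
  ring

theorem boundedSchurSum_zero (X : Finset ℝ) (hX : ∀ x ∈ X, 0 < x ∧ x < 1) (hne : X.Nonempty) :
    boundedSchurSum 0 X = 0 := by
  obtain ⟨n, hn⟩ : ∃ n, #X = n + 1 := ⟨#X - 1, by have := hne.card_pos; omega⟩
  set x := X.orderEmbOfFin hn with hxdef
  have hinj : Function.Injective x := x.injective
  have him : univ.image x = X := by
    ext y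
    rw [← mem_coe, coe_image, coe_univ, Set.image_univ, range_orderEmbOfFin, mem_coe]
  have hx : ∀ i, 0 < x i ∧ x i < 1 := fun i => hX _ (orderEmbOfFin_mem X hn i)
  have hdet := det_boundedMatrix 0 x hx hinj
  have h0 : (boundedMatrix 0 x).det = 0 := by
    rw [← Matrix.exists_mulVec_eq_zero_iff]
    -- For `M = 0` the two exponents in a row are exchanged by reversing the columns, so every row
    -- sums to zero.
    refine ⟨1, one_ne_zero, ?_⟩
    ext i
    simp only [Matrix.mulVec, dotProduct, boundedMatrix, Matrix.of_apply, Pi.one_apply, mul_one,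
      Pi.zero_apply, sum_sub_distrib]
    rw [sub_eq_zero, ← Equiv.sum_comp Fin.revPerm]
    refine sum_congr rfl fun j _ => ?_
    congr 1
    simp [Fin.val_rev]
  rw [h0, him] at hdet
  refine (mul_eq_zero.1 hdet.symm).resolve_left ?_
  refine mul_ne_zero (pairProd_ne_zero fun i _ j _ hij => sub_ne_zero.2 fun h => hij.ne' (hinj h))
    (mul_ne_zero (prod_ne_zero_iff.2 fun i _ => ?_) (pairProd_ne_zero fun i _ j _ _ => ?_))
  · have := hx i; linarith
  · have := hx i; have := hx j; nlinarith

/-! ### Summation of alternants. -/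

/-- The alternant `det (x i ^ l j)`, where `l` enumerates `L` increasingly. -/
noncomputable def alternant {n : ℕ} (x : Fin n → ℝ) (L : Finset ℕ) : ℝ :=
  if h : #L = n then (Matrix.of fun i j => x i ^ L.orderEmbOfFin h j).det else 0

theorem orderEmbOfFin_insert {n M : ℕ} {L : Finset ℕ} (hL : #L = n) (hM : L ⊆ range M)
    (h : #(insert M L) = n + 1) :
    ⇑((insert M L).orderEmbOfFin h) = Fin.snoc (α := fun _ => ℕ) (L.orderEmbOfFin hL) M := by
  refine (orderEmbOfFin_unique h (fun j => ?_) ?_).symm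
  · refine Fin.lastCases ?_ (fun j => ?_) j
    · simp
    · simp
  · intro a b hab
    induction b using Fin.lastCases with
    | last =>
      induction a using Fin.lastCases with
      | last => exact absurd hab (lt_irrefl _)
      | cast a =>
        simp only [Fin.snoc_castSucc, Fin.snoc_last]
        exact mem_range.1 (hM (orderEmbOfFin_mem L hL a))
    | cast b =>
      induction a using Fin.lastCases with
      | last => exact absurd hab (Fin.castSucc_lt_last b).not_gt
      | cast a =>
        simp only [Fin.snoc_castSucc]
        exact (L.orderEmbOfFin hL).strictMono (Fin.castSucc_lt_castSucc_iff.1 hab)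

/-- `M` exceeds every element of `L`, so it is the exponent of the last column; expand along that
column. -/
theorem alternant_insert {n M : ℕ} (x : Fin (n + 1) → ℝ) {L : Finset ℕ} (hL : #L = n)
    (hM : L ⊆ range M) : alternant x (insert M L) =
      ∑ i : Fin (n + 1), (-1) ^ (i + n : ℕ) * x i ^ M * alternant (fun j => x (i.succAbove j)) L := by
  have hmem : M ∉ L := fun h => lt_irrefl _ (mem_range.1 (hM h))
  have h : #(insert M L) = n + 1 := by rw [card_insert_of_notMem hmem, hL]
  unfold alternant
  rw [dif_pos h, Matrix.det_succ_column _ (Fin.last n)]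
  refine sum_congr rfl fun i _ => ?_
  rw [dif_pos hL]
  simp only [Matrix.of_apply, orderEmbOfFin_insert hL hM h, Fin.snoc_last, Fin.val_last]
  congr 2
  ext a b
  simp [Fin.succAbove_last]

theorem prod_range_sign (i : ℕ) {n : ℕ} (h : i ≤ n) :
    ∏ b ∈ range n, (if i ≤ b then (-1 : ℝ) else 1) = (-1) ^ (i + n) := by
  induction n, h using Nat.le_induction with
  | base =>
    rw [prod_congr rfl fun b hb => if_neg (not_le.2 (mem_range.1 hb)), prod_const_one,
      Even.neg_one_pow ⟨i, rfl⟩]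
  | succ n hn ih => rw [prod_range_succ, ih, if_pos hn, ← add_assoc, pow_succ]

/-- The sign counts the `n - i` indices above `i`, whose factors `x b - x i` are reversed. -/
theorem pairProd_sub_succAbove {n : ℕ} (x : Fin (n + 1) → ℝ) (i : Fin (n + 1)) :
    pairProd (fun a b => x b - x a) univ = (-1) ^ (i + n : ℕ) *
      pairProd (fun a b => x (i.succAbove b) - x (i.succAbove a)) univ *
        ∏ b, (x i - x (i.succAbove b)) := by
  have hsign : (-1 : ℝ) ^ (i + n : ℕ) = ∏ b : Fin n, if i < i.succAbove b then (-1 : ℝ) else 1 := by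
    rw [← prod_range_sign i (Nat.lt_succ_iff.1 i.2),
      ← Fin.prod_univ_eq_prod_range (fun b => if (i : ℕ) ≤ b then (-1 : ℝ) else 1) n]
    refine prod_congr rfl fun b _ => ?_
    simp only [Fin.lt_succAbove_iff_le_castSucc, Fin.le_def, Fin.val_castSucc]
  rw [hsign]
  unfold pairProd
  rw [Fin.prod_univ_succAbove _ i]
  simp only [Fin.prod_univ_succAbove (M := ℝ) _ i, lt_irrefl, if_false, one_mul, prod_mul_distrib,
    Fin.succAbove_lt_succAbove_iff]
  have key : (∏ b, if i < i.succAbove b then x (i.succAbove b) - x i else 1) *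
      (∏ b, if i.succAbove b < i then x i - x (i.succAbove b) else 1) =
      (∏ b : Fin n, if i < i.succAbove b then (-1 : ℝ) else 1) *
        ∏ b, (x i - x (i.succAbove b)) := by
    rw [← prod_mul_distrib, ← prod_mul_distrib]
    refine prod_congr rfl fun b _ => ?_
    rcases lt_trichotomy i (i.succAbove b) with h | h | h
    · simp [h, h.le.not_gt]
    · exact absurd h.symm (Fin.succAbove_ne i b)
    · simp [h, h.le.not_gt]
  linear_combination (∏ a : Fin n, ∏ b : Fin n,
    if a < b then x (i.succAbove b) - x (i.succAbove a) else 1) * key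

/-- The bounded sum of alternants. -/
theorem sum_alternant (M n : ℕ) (x : Fin n → ℝ) (hx : ∀ i, 0 < x i ∧ x i < 1)
    (hinj : Function.Injective x) : ∑ L ∈ powersetCard n (range M), alternant x L =
      pairProd (fun i j => x j - x i) univ * boundedSchurSum M (univ.image x) := by
  induction M generalizing n with
  | zero =>
    obtain _ | n := n
    · simp [alternant, boundedSchurSum, boundedCoeff]
    · rw [boundedSchurSum_zero _ (by simpa using hx) (by simp)]
      rw [powersetCard_eq_empty.2 (by simp)]
      simp
  | succ M ih =>
    obtain _ | n := n
    · simp [alternant, boundedSchurSum, boundedCoeff]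
    -- Subsets avoiding `M` give the induction hypothesis with the same variables; those containing
    -- `M` give it with one variable fewer.
    rw [boundedSchurSum_succ M _ (by simpa using hx), mul_add, ← ih _ x hx hinj, range_add_one,
      powersetCard_succ_insert notMem_range_self, sum_union, sum_image]
    · congr 1
      rw [sum_congr rfl fun L hL => alternant_insert x (mem_powersetCard.1 hL).2
        (mem_powersetCard.1 hL).1, sum_comm, sum_image hinj.injOn, mul_sum]
      refine sum_congr rfl fun i _ => ?_
      have hinj' : Function.Injective fun j => x (i.succAbove j) :=
        hinj.comp Fin.succAbove_right_injective
      have him : (univ.image x).erase (x i) = univ.image fun j => x (i.succAbove j) := by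
        rw [Fin.univ_succAbove n i, cons_eq_insert, image_insert, erase_insert, map_eq_image,
          image_image]
        · rfl
        · simp [hinj.eq_iff]
      rw [← mul_sum, ih _ _ (fun j => hx _) hinj', him, prod_image hinj'.injOn,
        pairProd_sub_succAbove x i]
      have : ∏ b, (x i - x (i.succAbove b)) ≠ 0 := prod_ne_zero_iff.2 fun b _ =>
        sub_ne_zero.2 fun h => Fin.succAbove_ne i b (hinj h).symm
      field_simp
    · intro A hA B hB hAB
      have hA' : M ∉ A := fun h => lt_irrefl _ (mem_range.1 ((mem_powersetCard.1 hA).1 h))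
      have hB' : M ∉ B := fun h => lt_irrefl _ (mem_range.1 ((mem_powersetCard.1 hB).1 h))
      rw [← erase_insert hA', ← erase_insert hB', hAB]
    · rw [disjoint_left]
      intro A hA hA'
      obtain ⟨B, -, rfl⟩ := mem_image.1 hA'
      exact lt_irrefl _ (mem_range.1 ((mem_powersetCard.1 hA).1 (mem_insert_self _ _)))

/-! ### The specialisation `x i = p ^ (2 * i + 1)`. -/

/-- The absolute value of the Vandermonde product of the numbers `q ^ a`, `a ∈ L`. -/
noncomputable def absVandermonde (q : ℝ) (L : Finset ℕ) : ℝ :=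
  pairProd (fun a b => |q ^ a - q ^ b|) L

open Polynomial in
/-- The polynomials with `(s - t) * f k (s ^ 2 + t ^ 2) = s ^ (2 k + 1) - t ^ (2 k + 1)` whenever
`s * t = c`. -/
noncomputable def oddDiffPoly (c : ℝ) : ℕ → Polynomial ℝ
  | 0 => 1
  | 1 => X + C c
  | k + 2 => X * oddDiffPoly c (k + 1) - C (c ^ 2) * oddDiffPoly c k

theorem oddDiffPoly_monic (c : ℝ) (k : ℕ) :
    (oddDiffPoly c k).Monic ∧ (oddDiffPoly c k).natDegree = k := by
  induction k using Nat.strong_induction_on with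
  | _ k ih =>
    match k with
    | 0 => simp [oddDiffPoly]
    | 1 => exact ⟨Polynomial.monic_X_add_C c, Polynomial.natDegree_X_add_C c⟩
    | k + 2 =>
      obtain ⟨m1, d1⟩ := ih (k + 1) (by omega)
      obtain ⟨m0, d0⟩ := ih k (by omega)
      have m2 : (Polynomial.X * oddDiffPoly c (k + 1)).Monic := Polynomial.monic_X.mul m1
      have d2 : (Polynomial.X * oddDiffPoly c (k + 1)).natDegree = k + 2 := by
        rw [Polynomial.Monic.natDegree_mul Polynomial.monic_X m1, Polynomial.natDegree_X, d1]
        omega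
      have hlt : (Polynomial.C (c ^ 2) * oddDiffPoly c k).natDegree <
          (Polynomial.X * oddDiffPoly c (k + 1)).natDegree := by
        have := Polynomial.natDegree_C_mul_le (c ^ 2) (oddDiffPoly c k)
        omega
      have hlt' : (Polynomial.C (c ^ 2) * oddDiffPoly c k).degree <
          (Polynomial.X * oddDiffPoly c (k + 1)).degree := Polynomial.degree_lt_degree hlt
      refine ⟨m2.sub_of_left hlt', ?_⟩
      rw [oddDiffPoly, Polynomial.natDegree_sub_eq_left_of_natDegree_lt hlt, d2]

theorem oddDiffPoly_eval {c s t : ℝ} (h : s * t = c) (k : ℕ) :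
    (s - t) * (oddDiffPoly c k).eval (s ^ 2 + t ^ 2) = s ^ (2 * k + 1) - t ^ (2 * k + 1) := by
  subst h
  induction k using Nat.strong_induction_on with
  | _ k ih =>
    match k with
    | 0 => simp [oddDiffPoly]
    | 1 => simp [oddDiffPoly]; ring
    | k + 2 =>
      have h1 := ih (k + 1) (by omega)
      have h0 := ih k (by omega)
      simp only [oddDiffPoly, Polynomial.eval_sub, Polynomial.eval_mul, Polynomial.eval_X,
        Polynomial.eval_C]
      linear_combination (s ^ 2 + t ^ 2) * h1 - (s * t) ^ 2 * h0

/-- With `s j * t j` constant, the odd differences divided by `s j - t j` are monic polynomials of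
degree `i` in `s j ^ 2 + t j ^ 2`, so the determinant reduces to a Vandermonde determinant. -/
theorem det_odd_pow_sub {n : ℕ} {c : ℝ} (s t : Fin n → ℝ) (h : ∀ j, s j * t j = c) :
    (Matrix.of fun i j : Fin n => s j ^ (2 * (i : ℕ) + 1) - t j ^ (2 * (i : ℕ) + 1)).det =
      (∏ j, (s j - t j)) *
        pairProd (fun i j => s j ^ 2 + t j ^ 2 - (s i ^ 2 + t i ^ 2)) univ := by
  rw [← det_vandermonde_eq_pairProd fun i => s i ^ 2 + t i ^ 2,
    Matrix.det_eval_matrixOfPolynomials_eq_det_vandermonde _ (fun i => oddDiffPoly c i)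
      (fun i => (oddDiffPoly_monic c i).2) (fun i => (oddDiffPoly_monic c i).1),
    ← Matrix.det_mul_column, ← Matrix.det_transpose]
  congr 1
  ext i j
  simp [oddDiffPoly_eval (h i)]

theorem pairProd_neg {α : Type*} [LinearOrder α] (f : α → α → ℝ) (X : Finset α) :
    pairProd (fun x y => -f x y) X = (-1) ^ (#X).choose 2 * pairProd f X := by
  rw [← pairProd_const, ← pairProd_mul]
  simp

theorem pairProd_fin_eq_range {n : ℕ} {f : ℕ → ℕ → ℝ} (hf : ∀ a b, f a b = f b a) :
    pairProd (fun i j : Fin n => f i j) univ = pairProd f (range n) := by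
  rw [← pairProd_image (e := fun i : Fin n => (i : ℕ)) hf Fin.val_injective.injOn]
  congr 1
  ext a
  simp only [mem_image, mem_univ, true_and, mem_range]
  exact ⟨fun ⟨i, hi⟩ => hi ▸ i.2, fun h => ⟨⟨a, h⟩, rfl⟩⟩

theorem pairProd_range_reflect {n : ℕ} {f : ℕ → ℕ → ℝ} (hf : ∀ a b, f a b = f b a) :
    pairProd (fun a b => f (n - 1 - a) (n - 1 - b)) (range n) = pairProd f (range n) := by
  rw [← pairProd_image (e := fun a => n - 1 - a) hf]
  · congr 1
    ext a
    simp only [mem_image, mem_range]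
    exact ⟨fun ⟨i, hi, h⟩ => by omega, fun h => ⟨n - 1 - a, by omega, by omega⟩⟩
  · intro a ha b hb hab
    simp only [coe_range, Set.mem_Iio] at ha hb hab
    omega

/-- The entry `p ^ ((2 i + 1) l)` equals `p ^ l * ((p ^ 2) ^ l) ^ i`: a scaled transposed
Vandermonde matrix. The sign arises because `(p ^ 2) ^ l` decreases in `l`. -/
theorem alternant_odd_pow {n : ℕ} {p : ℝ} (hp : 0 < p) (hp1 : p < 1) {L : Finset ℕ} (hL : #L = n) :
    alternant (fun i : Fin n => p ^ (2 * (i : ℕ) + 1)) L =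
      (-1) ^ n.choose 2 * ((∏ l ∈ L, p ^ l) * absVandermonde (p ^ 2) L) := by
  unfold alternant absVandermonde
  rw [dif_pos hL]
  have him : univ.image (L.orderEmbOfFin hL) = L := by
    ext y
    rw [← mem_coe, coe_image, coe_univ, Set.image_univ, range_orderEmbOfFin, mem_coe]
  have hinj := (L.orderEmbOfFin hL).injective
  have hprod : ∏ l ∈ L, p ^ l = ∏ j, p ^ L.orderEmbOfFin hL j := by
    conv_lhs => rw [← him, prod_image hinj.injOn]
  have hpair : pairProd (fun a b => |(p ^ 2) ^ a - (p ^ 2) ^ b|) L = pairProd (fun i j =>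
      |(p ^ 2) ^ L.orderEmbOfFin hL i - (p ^ 2) ^ L.orderEmbOfFin hL j|) univ := by
    conv_lhs => rw [← him, pairProd_image (fun a b => abs_sub_comm _ _) hinj.injOn]
  rw [hprod, hpair, mul_left_comm]
  have hc : #(univ : Finset (Fin n)) = n := by simp
  have := pairProd_neg (fun i j =>
    |(p ^ 2) ^ L.orderEmbOfFin hL i - (p ^ 2) ^ L.orderEmbOfFin hL j|) univ
  rw [hc] at this
  rw [← this, ← pairProd_congr (f := fun i j =>
    (p ^ 2) ^ L.orderEmbOfFin hL j - (p ^ 2) ^ L.orderEmbOfFin hL i),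
    ← det_vandermonde_eq_pairProd fun j => (p ^ 2) ^ L.orderEmbOfFin hL j,
    ← Matrix.det_transpose, ← Matrix.det_mul_column]
  · congr 1
    ext i j
    simp only [Matrix.transpose_apply, Matrix.of_apply, Matrix.vandermonde_apply]
    ring
  · intro i _ j _ hij
    have hlt := (L.orderEmbOfFin hL).strictMono hij
    rw [abs_of_pos, neg_sub]
    exact sub_pos.2 (pow_lt_pow_right_of_lt_one₀ (by positivity) (by nlinarith) hlt)

/-- The summation over `n`-subsets behind the enumeration of symmetric plane partitions. -/
theorem sum_absVandermonde {p : ℝ} (hp : 0 < p) (hp1 : p < 1) (n r : ℕ) :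
    (∑ L ∈ powersetCard n (range (n + r)), (∏ l ∈ L, p ^ l) * absVandermonde (p ^ 2) L) *
      ((∏ i ∈ range n, (1 - p ^ (2 * i + 1))) *
        pairProd (fun i j => 1 - p ^ (2 * (i + j + 1))) (range n)) =
      (∏ j ∈ range n, p ^ j) * (∏ j ∈ range n, (1 - p ^ (r + 1 + 2 * j))) *
        (absVandermonde (p ^ 2) (range n) *
          pairProd (fun i j => 1 - p ^ (2 * (r + 1 + i + j))) (range n)) := by
  set x : Fin n → ℝ := fun i => p ^ (2 * (i : ℕ) + 1) with hxdef
  have hinj : Function.Injective x := by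
    intro i j hij
    have := pow_right_injective₀ hp hp1.ne hij
    exact Fin.ext (by omega)
  have hx : ∀ i, 0 < x i ∧ x i < 1 := fun i =>
    ⟨pow_pos hp _, pow_lt_one₀ hp.le hp1 (by omega)⟩
  have h1 := sum_alternant (n + r) n x hx hinj
  have h2 := det_boundedMatrix (n + r) x hx hinj
  have hS : ∑ L ∈ powersetCard n (range (n + r)), alternant x L = (-1) ^ n.choose 2 *
      ∑ L ∈ powersetCard n (range (n + r)), (∏ l ∈ L, p ^ l) * absVandermonde (p ^ 2) L := by
    rw [mul_sum]
    exact sum_congr rfl fun L hL => alternant_odd_pow hp hp1 (mem_powersetCard.1 hL).2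
  -- The two exponents in column `j` add up to `n + r + n - 1` for every `j`, which is the constant
  -- product that `det_odd_pow_sub` requires.
  have hD : (boundedMatrix (n + r) x).det =
      (∏ j : Fin n, (p ^ (j : ℕ) - p ^ (n + r + n - 1 - j))) * pairProd (fun i j : Fin n =>
        (p ^ (j : ℕ)) ^ 2 + (p ^ (n + r + n - 1 - j)) ^ 2 -
          ((p ^ (i : ℕ)) ^ 2 + (p ^ (n + r + n - 1 - i)) ^ 2)) univ := by
    rw [← det_odd_pow_sub (c := p ^ (n + r + n - 1)) (fun j : Fin n => p ^ (j : ℕ))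
      (fun j : Fin n => p ^ (n + r + n - 1 - j))]
    · congr 1
      ext i j
      simp only [boundedMatrix, Matrix.of_apply, hxdef, ← pow_mul]
      rw [mul_comm (j : ℕ), mul_comm (n + r + n - 1 - (j : ℕ))]
    · intro j
      rw [← pow_add]
      congr 1
      have := j.2
      omega
  have hP1 : ∏ j : Fin n, (p ^ (j : ℕ) - p ^ (n + r + n - 1 - j)) =
      (∏ j ∈ range n, p ^ j) * ∏ j ∈ range n, (1 - p ^ (r + 1 + 2 * j)) := by
    rw [Fin.prod_univ_eq_prod_range (fun j => p ^ j - p ^ (n + r + n - 1 - j)) n,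
      ← prod_range_reflect (fun j => 1 - p ^ (r + 1 + 2 * j)), ← prod_mul_distrib]
    refine prod_congr rfl fun j hj => ?_
    have := mem_range.1 hj
    rw [mul_sub, mul_one, ← pow_add]
    congr 2
    omega
  -- With `s t = c`, each difference of `s ^ 2 + t ^ 2` at two indices factors into a difference of
  -- powers of `p ^ 2` and a factor `1 - p ^ _`; reflecting the indices brings the latter to the
  -- stated exponents.
  have hP2 : pairProd (fun i j : Fin n => (p ^ (j : ℕ)) ^ 2 + (p ^ (n + r + n - 1 - j)) ^ 2 -
      ((p ^ (i : ℕ)) ^ 2 + (p ^ (n + r + n - 1 - i)) ^ 2)) univ = (-1) ^ n.choose 2 *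
        (absVandermonde (p ^ 2) (range n) *
          pairProd (fun i j => 1 - p ^ (2 * (r + 1 + i + j))) (range n)) := by
    unfold absVandermonde
    rw [← pairProd_range_reflect (n := n) (f := fun i j => 1 - p ^ (2 * (r + 1 + i + j)))
      (fun a b => by rw [add_right_comm]), ← pairProd_mul]
    have hc : #(range n) = n := by simp
    have := pairProd_neg (fun a b => |(p ^ 2) ^ a - (p ^ 2) ^ b| *
      (1 - p ^ (2 * (r + 1 + (n - 1 - a) + (n - 1 - b))))) (range n)
    rw [hc] at this
    rw [← this, ← pairProd_fin_eq_range]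
    · refine pairProd_congr fun i _ j _ hij => ?_
      have hlt : (i : ℕ) < j := hij
      have hj := j.2
      rw [abs_of_pos (sub_pos.2 (pow_lt_pow_right_of_lt_one₀ (by positivity) (by nlinarith) hlt))]
      simp only [← pow_mul]
      have e1 : p ^ (2 * (i : ℕ)) * p ^ (2 * (r + 1 + (n - 1 - i) + (n - 1 - j))) =
          p ^ ((n + r + n - 1 - j) * 2) := by
        rw [← pow_add]; congr 1; omega
      have e2 : p ^ (2 * (j : ℕ)) * p ^ (2 * (r + 1 + (n - 1 - i) + (n - 1 - j))) =
          p ^ ((n + r + n - 1 - i) * 2) := by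
        rw [← pow_add]; congr 1; omega
      rw [← e1, ← e2, mul_comm (i : ℕ) 2, mul_comm (j : ℕ) 2]
      ring
    · intro a b
      rw [abs_sub_comm, add_right_comm]
  have hQ1 : ∏ i, (1 - x i) = ∏ i ∈ range n, (1 - p ^ (2 * i + 1)) :=
    Fin.prod_univ_eq_prod_range (fun i => 1 - p ^ (2 * i + 1)) n
  have hQ2 : pairProd (fun i j => 1 - x i * x j) univ =
      pairProd (fun i j => 1 - p ^ (2 * (i + j + 1))) (range n) := by
    rw [← pairProd_fin_eq_range (n := n) (f := fun i j => 1 - p ^ (2 * (i + j + 1)))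
      (fun a b => by rw [add_comm a b])]
    refine pairProd_congr fun i _ j _ _ => ?_
    simp only [hxdef, ← pow_add]
    congr 2
    ring
  rw [hS] at h1
  rw [hD, hP1, hP2, hQ1, hQ2] at h2
  have hsq : ((-1 : ℝ) ^ n.choose 2) ^ 2 = 1 := by rw [← pow_mul, mul_comm, pow_mul]; simp
  generalize (-1 : ℝ) ^ n.choose 2 = e at *
  have hmul := congrArg (fun z => e * z * ((∏ i ∈ range n, (1 - p ^ (2 * i + 1))) *
        pairProd (fun i j => 1 - p ^ (2 * (i + j + 1))) (range n))) h1
  beta_reduce at hmul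
  linear_combination hmul - e * h2 + (-(∑ L ∈ powersetCard n (range (n + r)), (∏ l ∈ L, p ^ l) *
    absVandermonde (p ^ 2) L) * ((∏ i ∈ range n, (1 - p ^ (2 * i + 1))) *
        pairProd (fun i j => 1 - p ^ (2 * (i + j + 1))) (range n)) +
      (∏ j ∈ range n, p ^ j) * (∏ j ∈ range n, (1 - p ^ (r + 1 + 2 * j))) *
        (absVandermonde (p ^ 2) (range n) *
          pairProd (fun i j => 1 - p ^ (2 * (r + 1 + i + j))) (range n))) * hsq

/-! ### From tuples to subsets. -/

theorem card_injective_image_eq {M r : ℕ} {K : Finset ℕ} (hK : K ∈ powersetCard r (range M)) :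
    #{κ : Fin r → Fin M | Function.Injective κ ∧ univ.image (fun i => (κ i : ℕ)) = K} =
      r.factorial := by
  obtain ⟨hKM, hKr⟩ := mem_powersetCard.1 hK
  have hlt : ∀ k : K, (k : ℕ) < M := fun k => mem_range.1 (hKM k.2)
  have hcard : Fintype.card (Fin r ↪ K) = r.factorial := by
    rw [Fintype.card_embedding_eq, Fintype.card_coe, hKr, Fintype.card_fin, Nat.descFactorial_self]
  rw [← hcard, ← card_univ]
  symm
  refine card_bij (fun e _ i => ⟨e i, hlt _⟩) ?_ ?_ ?_
  · intro e _
    rw [mem_filter]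
    have hinj : Function.Injective fun i => (e i : ℕ) := Subtype.val_injective.comp e.injective
    refine ⟨mem_univ _, fun i j hij => hinj (by simpa using hij), ?_⟩
    refine eq_of_subset_of_card_le ?_ ?_
    · intro y hy
      obtain ⟨i, -, rfl⟩ := mem_image.1 hy
      exact (e i).2
    · rw [card_image_of_injective _ hinj]
      simp [hKr]
  · intro e _ e' _ h
    ext i
    simpa using congrFun h i
  · intro κ hκ
    obtain ⟨-, hinj, him⟩ := mem_filter.1 hκ
    refine ⟨⟨fun i => ⟨κ i, him ▸ mem_image_of_mem _ (mem_univ i)⟩, fun i j hij => ?_⟩, mem_univ _,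
      ?_⟩
    · exact hinj (Fin.ext (by simpa using hij))
    · rfl

/-- A symmetric sum over `r`-tuples that vanishes on repeated entries is `r!` times a sum over
`r`-subsets. -/
theorem sum_tuple_eq_factorial_mul (M r : ℕ) {h : ℕ → ℕ → ℝ} (g : ℕ → ℝ)
    (hsymm : ∀ a b, h a b = h b a) (hdiag : ∀ a, h a a = 0) :
    ∑ κ : Fin r → Fin M, (∏ i, ∏ j ∈ Ioi i, h (κ i) (κ j)) * ∏ i, g (κ i) =
      r.factorial * ∑ K ∈ powersetCard r (range M), pairProd h K * ∏ k ∈ K, g k := by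
  classical
  rw [← sum_filter_add_sum_filter_not univ fun κ : Fin r → Fin M => Function.Injective κ]
  have hnot : ∀ κ ∈ ({κ : Fin r → Fin M | ¬ Function.Injective κ} : Finset _),
      (∏ i, ∏ j ∈ Ioi i, h (κ i) (κ j)) * ∏ i, g (κ i) = 0 := by
    intro κ hκ
    have := (mem_filter.1 hκ).2
    rw [Function.Injective] at this
    push Not at this
    obtain ⟨a, b, hab, hne⟩ := this
    rw [mul_eq_zero]
    left
    rcases lt_or_gt_of_ne hne with hlt | hlt
    · exact prod_eq_zero (mem_univ a) (prod_eq_zero (mem_Ioi.2 hlt) (by rw [hab, hdiag]))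
    · exact prod_eq_zero (mem_univ b) (prod_eq_zero (mem_Ioi.2 hlt) (by rw [hab, hdiag]))
  rw [sum_eq_zero hnot, add_zero, mul_sum]
  have hmaps : ∀ κ ∈ ({κ : Fin r → Fin M | Function.Injective κ} : Finset _),
      univ.image (fun i => (κ i : ℕ)) ∈ powersetCard r (range M) := by
    intro κ hκ
    have hinj : Function.Injective fun i => (κ i : ℕ) :=
      Fin.val_injective.comp (mem_filter.1 hκ).2
    rw [mem_powersetCard, card_image_of_injective _ hinj]
    refine ⟨fun y hy => ?_, by simp⟩
    obtain ⟨i, -, rfl⟩ := mem_image.1 hy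
    exact mem_range.2 (κ i).2
  rw [← sum_fiberwise_of_maps_to hmaps]
  refine sum_congr rfl fun K hK => ?_
  rw [filter_filter, ← card_injective_image_eq hK, ← nsmul_eq_mul, ← sum_const]
  refine sum_congr rfl fun κ hκ => ?_
  obtain ⟨-, hinj, him⟩ := mem_filter.1 hκ
  have hinj' : Function.Injective fun i => (κ i : ℕ) := Fin.val_injective.comp hinj
  rw [← him, pairProd_image hsymm hinj'.injOn, pairProd_univ, prod_image hinj'.injOn]

theorem prod_prod_Ioi_right {r : ℕ} (w : Fin r → ℝ) :
    ∏ i, ∏ j ∈ Ioi i, w j = ∏ j : Fin r, w j ^ (j : ℕ) := by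
  rw [prod_comm' (t' := univ) (s' := fun j => Iio j) (by simp)]
  simp

theorem prod_prod_Ioi_const (r : ℕ) (c : ℝ) : ∏ i : Fin r, ∏ _j ∈ Ioi i, c = c ^ r.choose 2 := by
  rw [← pairProd_univ, pairProd_const]
  simp

/-- The summand of the `q`-sum, in a form that is symmetric in the entries of `κ`. -/
theorem summand_symmetric {q : ℝ} (hq : 0 < q) (hq1 : q < 1) (r N : ℕ) (n : ℝ)
    (κ : Fin r → Fin (N + 1)) :
    (∏ i, ∏ j ∈ Ioi i, |DMM.qNum q (((κ i : ℝ) - n) - ((κ j : ℝ) - n))|) *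
        ∏ i, (q ^ (((κ i : ℝ) - n + n - (r : ℝ) + ((i : ℕ) + 1 : ℝ)) ^ 2 / 2) *
            DMM.qBinom q N (κ i)) =
      (((1 - q)⁻¹) ^ r.choose 2 * ∏ i : Fin r, q ^ (((i : ℕ) + 1 - r : ℝ) ^ 2 / 2)) *
        ((∏ i, ∏ j ∈ Ioi i, |q ^ (κ i : ℕ) - q ^ (κ j : ℕ)|) *
          ∏ i, (q ^ (((κ i : ℕ) : ℝ) ^ 2 / 2 + (κ i : ℕ) * (1 - r : ℝ)) * DMM.qBinom q N (κ i))) := by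
  have h1 : ∀ i j : Fin r, |DMM.qNum q (((κ i : ℝ) - n) - ((κ j : ℝ) - n))| =
      (1 - q)⁻¹ * (|q ^ (κ i : ℕ) - q ^ (κ j : ℕ)| * (q ^ (κ j : ℕ))⁻¹) := by
    intro i j
    have hj : 0 < q ^ (κ j : ℕ) := pow_pos hq _
    rw [DMM.qNum, sub_sub_sub_cancel_right, Real.rpow_sub hq, Real.rpow_natCast, Real.rpow_natCast,
      abs_div, abs_of_pos (sub_pos.2 hq1), ← abs_of_pos (inv_pos.2 hj), ← abs_mul,
      abs_sub_comm 1, sub_mul, mul_inv_cancel₀ hj.ne', div_eq_inv_mul, div_eq_mul_inv]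
  have h2 : ∀ i : Fin r, q ^ (((κ i : ℝ) - n + n - (r : ℝ) + ((i : ℕ) + 1 : ℝ)) ^ 2 / 2) *
      DMM.qBinom q N (κ i) = q ^ (((i : ℕ) + 1 - r : ℝ) ^ 2 / 2) *
        (q ^ (((κ i : ℕ) : ℝ) ^ 2 / 2 + (κ i : ℕ) * (1 - r : ℝ)) * DMM.qBinom q N (κ i)) *
          (q ^ (κ i : ℕ)) ^ (i : ℕ) := by
    intro i
    have : (((κ i : ℝ) - n + n - (r : ℝ) + ((i : ℕ) + 1 : ℝ)) ^ 2 / 2) =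
        (((i : ℕ) + 1 - r : ℝ) ^ 2 / 2) + ((((κ i : ℕ) : ℝ) ^ 2 / 2 + (κ i : ℕ) * (1 - r : ℝ))) +
          (((κ i : ℕ) * (i : ℕ) : ℕ) : ℝ) := by
      push_cast; ring
    rw [this, Real.rpow_add hq, Real.rpow_add hq, Real.rpow_natCast, pow_mul]
    ring
  simp only [h1, h2, prod_mul_distrib]
  rw [prod_prod_Ioi_const, prod_prod_Ioi_right fun j => (q ^ (κ j : ℕ))⁻¹]
  -- The index `j` is the larger one in exactly `j` pairs, so the powers extracted from the
  -- `q`-numbers cancel the cross terms `κ j * j` of the expanded squares.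
  have h3 : (∏ j : Fin r, (q ^ (κ j : ℕ))⁻¹ ^ (j : ℕ)) * ∏ j : Fin r, (q ^ (κ j : ℕ)) ^ (j : ℕ) = 1 := by
    rw [← prod_mul_distrib]
    refine prod_eq_one fun j _ => ?_
    rw [← mul_pow, inv_mul_cancel₀ (pow_pos hq _).ne', one_pow]
  linear_combination ((1 - q)⁻¹ ^ r.choose 2 * (∏ i : Fin r, ∏ j ∈ Ioi i,
    |q ^ (κ i : ℕ) - q ^ (κ j : ℕ)|) * (∏ i : Fin r, q ^ (((i : ℕ) + 1 - r : ℝ) ^ 2 / 2)) *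
    (∏ i : Fin r, q ^ (((κ i : ℕ) : ℝ) ^ 2 / 2 + (κ i : ℕ) * (1 - r : ℝ))) *
      ∏ i : Fin r, DMM.qBinom q N (κ i)) * h3

/-! ### Complementary subsets and removal of the `q`-binomial coefficients. -/

/-- On both sides a pair inside `K` is counted twice, and a pair meeting `K` once or not at all is
counted once. -/
theorem pairProd_mul_pairProd_of_subset {α R : Type*} [LinearOrder α] [CommMonoid R]
    {f : α → α → R} (hf : ∀ x y, f x y = f y x) {K X : Finset α} (hK : K ⊆ X) :
    pairProd f K * pairProd f X =
      pairProd f (X \ K) * ∏ a ∈ K, ∏ b ∈ X.erase a, f a b := by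
  induction K using Finset.induction with
  | empty => simp
  | insert a K ha ih =>
    have haX : a ∈ X := hK (mem_insert_self _ _)
    have hKX : K ⊆ X := (subset_insert _ _).trans hK
    have ih := ih hKX
    have h1 : pairProd f (X \ K) =
        (∏ y ∈ (X \ K).erase a, f a y) * pairProd f (X \ insert a K) := by
      rw [pairProd_erase hf (mem_sdiff.2 ⟨haX, ha⟩), sdiff_insert]
    have h2 : ∏ b ∈ X.erase a, f a b = (∏ y ∈ K, f a y) * ∏ y ∈ (X \ K).erase a, f a y := by
      have hsub : K ⊆ X.erase a := fun y hy =>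
        mem_erase.2 ⟨fun h => ha (h ▸ hy), hKX hy⟩
      rw [← prod_sdiff hsub, mul_comm, erase_sdiff_comm]
    rw [pairProd_insert hf ha, prod_insert ha, h2]
    calc _ = (∏ y ∈ K, f a y) * (pairProd f K * pairProd f X) := by ac_rfl
      _ = _ := by rw [ih, h1]; ac_rfl

/-- The product `(1 - q) (1 - q ^ 2) ⋯ (1 - q ^ m)`. -/
noncomputable def qEuler (q : ℝ) (m : ℕ) : ℝ := ∏ k ∈ range m, (1 - q ^ (k + 1))

theorem qEuler_succ (q : ℝ) (m : ℕ) : qEuler q (m + 1) = qEuler q m * (1 - q ^ (m + 1)) :=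
  prod_range_succ _ _

theorem qEuler_pos {q : ℝ} (hq : 0 < q) (hq1 : q < 1) (m : ℕ) : 0 < qEuler q m :=
  prod_pos fun _ _ => sub_pos.2 (pow_lt_one₀ hq.le hq1 (by omega))

theorem qEuler_add (q : ℝ) (m k : ℕ) :
    qEuler q (m + k) = qEuler q m * ∏ i ∈ range k, (1 - q ^ (m + i + 1)) :=
  prod_range_add _ _ _

theorem qBinom_eq {q : ℝ} (hq : 0 < q) (hq1 : q < 1) {N a : ℕ} (ha : a ≤ N) :
    DMM.qBinom q N a = qEuler q N / (qEuler q (N - a) * qEuler q a) := by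
  have h1 : DMM.qPoch q q a = qEuler q a := by
    rw [← Int.ofNat_eq_natCast, DMM.qPoch, qEuler]
    exact prod_congr rfl fun k _ => by rw [pow_succ']
  have h2 : qEuler q N = qEuler q (N - a) * DMM.qPoch (q ^ (N - a + 1)) q a := by
    conv_lhs => rw [← Nat.sub_add_cancel ha, qEuler_add]
    rw [← Int.ofNat_eq_natCast, DMM.qPoch]
    congr 1
    exact prod_congr rfl fun k _ => by rw [← pow_add]; congr 2; ring
  have := (qEuler_pos hq hq1 (N - a)).ne'
  rw [DMM.qBinom, h1, h2, mul_div_mul_left _ _ this]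

theorem prod_range_pow_eq_rpow {q : ℝ} (hq : 0 < q) (a : ℕ) :
    ∏ b ∈ range a, q ^ b = q ^ ((a : ℝ) * (a - 1) / 2) := by
  induction a with
  | zero => simp
  | succ a ih =>
    rw [prod_range_succ, ih, ← Real.rpow_natCast, ← Real.rpow_add hq]
    congr 1
    push_cast
    ring

theorem prod_abs_pow_sub_lt {q : ℝ} (hq : 0 < q) (hq1 : q < 1) (a : ℕ) :
    ∏ b ∈ range a, |q ^ a - q ^ b| = q ^ ((a : ℝ) * (a - 1) / 2) * qEuler q a := by
  rw [← prod_range_pow_eq_rpow hq, qEuler, ← prod_range_reflect (fun k => 1 - q ^ (k + 1)),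
    ← prod_mul_distrib]
  refine prod_congr rfl fun b hb => ?_
  have hb := mem_range.1 hb
  rw [abs_sub_comm, abs_of_pos (sub_pos.2 (pow_lt_pow_right_of_lt_one₀ hq hq1 hb)), mul_sub,
    mul_one, ← pow_add]
  congr 2
  omega

/-- Supplies the denominator of `qBinom q N a`, together with a power of `q` that is quadratic in
`a`. -/
theorem prod_erase_abs_pow_sub {q : ℝ} (hq : 0 < q) (hq1 : q < 1) {N a : ℕ} (ha : a ≤ N) :
    ∏ b ∈ (range (N + 1)).erase a, |q ^ a - q ^ b| =
      q ^ ((a : ℝ) * (a - 1) / 2 + a * (N - a)) * (qEuler q (N - a) * qEuler q a) := by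
  have h1 : ∏ b ∈ (range (N + 1)).erase a, |q ^ a - q ^ b| =
      ∏ b ∈ range (a + 1 + (N - a)), if b = a then 1 else |q ^ a - q ^ b| := by
    rw [show a + 1 + (N - a) = N + 1 by omega,
      ← mul_prod_erase (range (N + 1)) _ (mem_range.2 (by omega : a < N + 1)), if_pos rfl, one_mul]
    exact prod_congr rfl fun b hb => by rw [if_neg (mem_erase.1 hb).1]
  have h2 : ∏ b ∈ range a, (if b = a then 1 else |q ^ a - q ^ b|) =
      ∏ b ∈ range a, |q ^ a - q ^ b| :=
    prod_congr rfl fun b hb => by rw [if_neg (mem_range.1 hb).ne]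
  have h3 : ∏ b ∈ range (N - a), (if a + 1 + b = a then 1 else |q ^ a - q ^ (a + 1 + b)|) =
      (q ^ a) ^ (N - a) * qEuler q (N - a) := by
    have hc : (q ^ a) ^ (N - a) = ∏ _b ∈ range (N - a), q ^ a := by simp
    rw [hc, qEuler, ← prod_mul_distrib]
    refine prod_congr rfl fun b _ => ?_
    rw [if_neg (by omega), abs_of_pos (sub_pos.2 (pow_lt_pow_right_of_lt_one₀ hq hq1 (by omega))),
      mul_sub, mul_one, ← pow_add]
    congr 2
    omega
  rw [h1, prod_range_add, prod_range_succ, if_pos rfl, mul_one, h2, h3,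
    prod_abs_pow_sub_lt hq hq1, Real.rpow_add hq, ← pow_mul, ← Real.rpow_natCast]
  push_cast [Nat.cast_sub ha]
  ring

theorem absVandermonde_range_succ {q : ℝ} (hq : 0 < q) (hq1 : q < 1) (m : ℕ) :
    absVandermonde q (range (m + 1)) =
      q ^ ((m : ℝ) * (m - 1) / 2) * qEuler q m * absVandermonde q (range m) := by
  unfold absVandermonde
  rw [range_add_one, pairProd_insert (fun a b => abs_sub_comm _ _) notMem_range_self,
    prod_abs_pow_sub_lt hq hq1]

theorem absVandermonde_range {q : ℝ} (hq : 0 < q) (hq1 : q < 1) (m : ℕ) :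
    absVandermonde q (range m) =
      q ^ ((m : ℝ) * (m - 1) * (m - 2) / 6) * ∏ k ∈ range m, qEuler q k := by
  induction m with
  | zero => simp [absVandermonde]
  | succ m ih =>
    rw [absVandermonde_range_succ hq hq1, ih, prod_range_succ]
    rw [show ((m + 1 : ℕ) : ℝ) * ((m + 1 : ℕ) - 1) * ((m + 1 : ℕ) - 2) / 6 =
      (m : ℝ) * (m - 1) / 2 + (m : ℝ) * (m - 1) * (m - 2) / 6 by push_cast; ring,
      Real.rpow_add hq]
    ring

theorem absVandermonde_pos {q : ℝ} (hq : 0 < q) (hq1 : q < 1) (m : ℕ) :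
    0 < absVandermonde q (range m) := by
  rw [absVandermonde_range hq hq1]
  exact mul_pos (Real.rpow_pos_of_pos hq _) (prod_pos fun k _ => qEuler_pos hq hq1 k)

theorem prod_pow_eq_rpow_sum {q : ℝ} (hq : 0 < q) {α : Type*} (s : Finset α) (f : α → ℝ) :
    ∏ k ∈ s, q ^ f k = q ^ ∑ k ∈ s, f k := (Real.rpow_sum_of_pos hq f s).symm

/-- Passing to complements turns `q`-binomial weights into monomial weights. -/
theorem absVandermonde_mul_prod_qBinom {q : ℝ} (hq : 0 < q) (hq1 : q < 1) {N r : ℕ} {K : Finset ℕ}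
    (hK : K ∈ powersetCard r (range (N + 1))) :
    absVandermonde q K *
        ∏ k ∈ K, (q ^ ((k : ℝ) ^ 2 / 2 + k * (1 - r : ℝ)) * DMM.qBinom q N k) =
      qEuler q N ^ r / absVandermonde q (range (N + 1)) *
        (absVandermonde q (range (N + 1) \ K) * q ^ ((N - r + 1 / 2 : ℝ) * ∑ k ∈ K, (k : ℝ))) := by
  obtain ⟨hKN, hKr⟩ := mem_powersetCard.1 hK
  have hle : ∀ k ∈ K, k ≤ N := fun k hk => Nat.lt_succ_iff.1 (mem_range.1 (hKN hk))
  have hcompl := pairProd_mul_pairProd_of_subset (f := fun a b => |q ^ a - q ^ b|)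
    (fun a b => abs_sub_comm _ _) hKN
  change absVandermonde q K * absVandermonde q (range (N + 1)) =
    absVandermonde q (range (N + 1) \ K) * _ at hcompl
  have hV := (absVandermonde_pos hq hq1 (N + 1)).ne'
  rw [mul_sum, ← prod_pow_eq_rpow_sum hq, div_mul_eq_mul_div, eq_div_iff hV, mul_right_comm, hcompl,
    mul_assoc, ← prod_mul_distrib, ← hKr, ← prod_const, mul_left_comm, ← prod_mul_distrib]
  congr 1
  refine prod_congr rfl fun k hk => ?_
  have h1 := (qEuler_pos hq hq1 (N - k)).ne'
  have h2 := (qEuler_pos hq hq1 k).ne'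
  rw [prod_erase_abs_pow_sub hq hq1 (hle k hk), qBinom_eq hq hq1 (hle k hk)]
  -- The terms quadratic in `k` cancel, which is why the remaining weight is a power of `q` linear
  -- in `∑ k`.
  rw [show (((N : ℝ) - (#K : ℕ) + 1 / 2) * k) = ((k : ℝ) * (k - 1) / 2 + k * (N - k)) +
    ((k : ℝ) ^ 2 / 2 + k * (1 - (#K : ℕ))) by ring,
    Real.rpow_add hq ((k : ℝ) * (k - 1) / 2 + k * (N - k))]
  generalize q ^ ((k : ℝ) * (k - 1) / 2 + k * (N - k)) = u
  generalize q ^ ((k : ℝ) ^ 2 / 2 + k * (1 - (#K : ℕ))) = v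
  field_simp

/-- Each factor changes by `q ^ (N - a - b)`, and every element lies in `n - 1` pairs. -/
theorem absVandermonde_image_reflect {q : ℝ} (hq : 0 < q) {N n : ℕ} {L : Finset ℕ}
    (hL : L ∈ powersetCard n (range (N + 1))) :
    absVandermonde q (L.image fun a => N - a) =
      q ^ ((N : ℝ) * (n * (n - 1) / 2) - (n - 1) * ∑ l ∈ L, (l : ℝ)) * absVandermonde q L := by
  obtain ⟨hLN, hLn⟩ := mem_powersetCard.1 hL
  have hle : ∀ k ∈ L, k ≤ N := fun k hk => Nat.lt_succ_iff.1 (mem_range.1 (hLN hk))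
  have hinj : Set.InjOn (fun a => N - a) L := by
    intro a ha b hb hab
    have := hle a ha; have := hle b hb
    simp only at hab
    omega
  unfold absVandermonde
  rw [pairProd_image (fun a b => abs_sub_comm _ _) hinj]
  have h1 : pairProd (fun i j : ℕ => |q ^ (N - i) - q ^ (N - j)|) L =
      pairProd (fun i j : ℕ => (q ^ (N : ℝ) * (q ^ (-(i : ℝ)) * q ^ (-(j : ℝ)))) * |q ^ i - q ^ j|) L := by
    refine pairProd_congr fun a ha b hb _ => ?_
    have hpos : 0 < q ^ (N : ℝ) * (q ^ (-(a : ℝ)) * q ^ (-(b : ℝ))) := by positivity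
    rw [← abs_of_pos hpos, ← abs_mul, abs_sub_comm]
    congr 1
    rw [← Real.rpow_natCast, ← Real.rpow_natCast, ← Real.rpow_natCast q a, ← Real.rpow_natCast q b,
      Nat.cast_sub (hle a ha), Nat.cast_sub (hle b hb), mul_sub, ← Real.rpow_add hq,
      ← Real.rpow_add hq, ← Real.rpow_add hq, ← Real.rpow_add hq]
    congr 2 <;> ring
  rw [h1, pairProd_mul, pairProd_mul, pairProd_const, hLn]
  congr 1
  have h2 := pairProd_mul_self (fun a : ℕ => q ^ (-(a : ℝ))) L
  rw [prod_pow_eq_rpow_sum hq, hLn, sum_neg_distrib] at h2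
  have h3 : q ^ (-∑ l ∈ L, (l : ℝ)) ≠ 0 := (Real.rpow_pos_of_pos hq _).ne'
  rw [eq_div_of_mul_eq h3 h2, ← Real.rpow_natCast, ← Real.rpow_natCast, ← Real.rpow_mul hq.le,
    ← Real.rpow_mul hq.le, ← Real.rpow_sub hq, ← Real.rpow_add hq, Nat.cast_choose_two]
  congr 1
  ring

theorem image_reflect_image_reflect {N : ℕ} {L : Finset ℕ} (hL : L ⊆ range (N + 1)) :
    (L.image fun a => N - a).image (fun a => N - a) = L := by
  rw [image_image]
  conv_rhs => rw [← image_id (s := L)]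
  refine image_congr fun a ha => ?_
  have := mem_range.1 (hL ha)
  simp only [Function.comp, id]
  omega

theorem image_reflect_mem {N n : ℕ} {L : Finset ℕ} (hL : L ∈ powersetCard n (range (N + 1))) :
    L.image (fun a => N - a) ∈ powersetCard n (range (N + 1)) := by
  obtain ⟨h1, h2⟩ := mem_powersetCard.1 hL
  refine mem_powersetCard.2 ⟨fun y hy => ?_, ?_⟩
  · obtain ⟨a, -, rfl⟩ := mem_image.1 hy
    exact mem_range.2 (by omega)
  · rw [card_image_of_injOn, h2]
    intro a ha b hb hab
    have := mem_range.1 (h1 ha); have := mem_range.1 (h1 hb)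
    simp only at hab
    omega

theorem compl_mem_powersetCard {N n r : ℕ} (h : N + 1 = n + r) {L : Finset ℕ}
    (hL : L ∈ powersetCard n (range (N + 1))) : range (N + 1) \ L ∈ powersetCard r (range (N + 1)) := by
  obtain ⟨h1, h2⟩ := mem_powersetCard.1 hL
  refine mem_powersetCard.2 ⟨sdiff_subset, ?_⟩
  rw [card_sdiff_of_subset h1, card_range]
  omega

theorem sum_range_cast (m : ℕ) : ∑ k ∈ range m, (k : ℝ) = (m : ℝ) * (m - 1) / 2 := by
  induction m with
  | zero => simp
  | succ m ih => rw [sum_range_succ, ih]; push_cast; ring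

/-- Substitute for `K` the complement of the reflection of `L`. As `N - r + 1/2 = n - 1/2`, the
weight contributes `(n - 1/2) ∑ l` to the exponent and the reflected Vandermonde product `-(n - 1) ∑
l`, leaving `(∑ l) / 2`, the weight in `sum_absVandermonde`. -/
theorem sum_subsets_qBinom {q : ℝ} (hq : 0 < q) (hq1 : q < 1) {N n r : ℕ} (h : N + 1 = n + r) :
    ∑ K ∈ powersetCard r (range (N + 1)), absVandermonde q K *
        ∏ k ∈ K, (q ^ ((k : ℝ) ^ 2 / 2 + k * (1 - r : ℝ)) * DMM.qBinom q N k) =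
      qEuler q N ^ r / absVandermonde q (range (N + 1)) *
        (q ^ ((n - 1 / 2) * ((N + 1) * N / 2 - n * N) + N * (n * (n - 1)) / 2 : ℝ) *
          ∑ L ∈ powersetCard n (range (N + 1)),
            q ^ ((∑ l ∈ L, (l : ℝ)) / 2) * absVandermonde q L) := by
  rw [mul_sum, mul_sum]
  symm
  refine sum_bij' (fun L _ => range (N + 1) \ L.image fun a => N - a)
    (fun K _ => (range (N + 1) \ K).image fun a => N - a) ?_ ?_ ?_ ?_ ?_
  · exact fun L hL => compl_mem_powersetCard h (image_reflect_mem hL)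
  · exact fun K hK => image_reflect_mem (compl_mem_powersetCard (by omega) hK)
  · intro L hL
    have hR := image_reflect_mem hL
    rw [Finset.sdiff_sdiff_eq_self (mem_powersetCard.1 hR).1,
      image_reflect_image_reflect (mem_powersetCard.1 hL).1]
  · intro K hK
    rw [image_reflect_image_reflect sdiff_subset, Finset.sdiff_sdiff_eq_self (mem_powersetCard.1 hK).1]
  · intro L hL
    have hR := image_reflect_mem hL
    have hLN := (mem_powersetCard.1 hL).1
    rw [absVandermonde_mul_prod_qBinom hq hq1 (compl_mem_powersetCard h hR),
      Finset.sdiff_sdiff_eq_self (mem_powersetCard.1 hR).1, absVandermonde_image_reflect hq hL]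
    have hle : ∀ k ∈ L, k ≤ N := fun k hk => Nat.lt_succ_iff.1 (mem_range.1 (hLN hk))
    have hinj : Set.InjOn (fun a => N - a) L := by
      intro a ha b hb hab
      have := hle a ha; have := hle b hb
      simp only at hab
      omega
    have hs1 : ∑ k ∈ range (N + 1) \ L.image (fun a => N - a), (k : ℝ) =
        (N + 1) * N / 2 - (n * N - ∑ l ∈ L, (l : ℝ)) := by
      rw [eq_sub_iff_add_eq]
      have h1 : (n * N - ∑ l ∈ L, (l : ℝ)) = ∑ k ∈ L.image (fun a => N - a), (k : ℝ) := by
        rw [sum_image hinj, sum_congr rfl fun k hk => Nat.cast_sub (hle k hk), sum_sub_distrib,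
          sum_const, (mem_powersetCard.1 hL).2, nsmul_eq_mul]
      rw [h1, sum_sdiff (mem_powersetCard.1 hR).1, sum_range_cast]
      push_cast
      ring
    have hr : (r : ℝ) = N + 1 - n := by
      have : ((N + 1 : ℕ) : ℝ) = ((n + r : ℕ) : ℝ) := by rw [h]
      push_cast at this
      linarith
    rw [hs1, hr, ← mul_assoc (q ^ _) (q ^ _), ← Real.rpow_add hq, mul_right_comm,
      ← Real.rpow_add hq]
    congr 3
    ring

/-! ### Closed form of the `q`-sum. -/

theorem prod_rpow_sq_div_two {q : ℝ} (hq : 0 < q) (r : ℕ) :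
    ∏ i : Fin r, q ^ (((i : ℕ) + 1 - r : ℝ) ^ 2 / 2) =
      q ^ ((r : ℝ) * (r - 1) * (2 * r - 1) / 12) := by
  have h : ∀ m : ℕ, ∑ j ∈ range m, ((j : ℝ) ^ 2 / 2) = (m : ℝ) * (m - 1) * (2 * m - 1) / 12 := by
    intro m
    induction m with
    | zero => simp
    | succ m ih => rw [sum_range_succ, ih]; push_cast; ring
  rw [prod_pow_eq_rpow_sum hq, ← h,
    Fin.sum_univ_eq_sum_range (fun i => (((i : ℕ) + 1 - r : ℝ) ^ 2 / 2)) r,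
    ← sum_range_reflect (fun j : ℕ => (j : ℝ) ^ 2 / 2)]
  congr 1
  refine sum_congr rfl fun i hi => ?_
  have := mem_range.1 hi
  rw [Nat.sub_sub, Nat.cast_sub (by omega)]
  push_cast
  ring

/-- Closed form of the `q`-sum divided by `r!`, where `q = p ^ 2` and `N + 1 = n + r`. -/
noncomputable def qSumClosed (p : ℝ) (r n : ℕ) : ℝ :=
  (1 - p ^ 2)⁻¹ ^ r.choose 2 * qEuler (p ^ 2) (n + r - 1) ^ r *
    ((∏ k ∈ range n, qEuler (p ^ 2) k) / ∏ k ∈ range (n + r), qEuler (p ^ 2) k) *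
      ((∏ j ∈ range n, (1 - p ^ (r + 1 + 2 * j))) / ∏ j ∈ range n, (1 - p ^ (2 * j + 1))) *
        (pairProd (fun i j => 1 - p ^ (2 * (r + 1 + i + j))) (range n) /
          pairProd (fun i j => 1 - p ^ (2 * (i + j + 1))) (range n))

theorem sum_subsets_eq_qSumClosed {p : ℝ} (hp : 0 < p) (hp1 : p < 1) {N n r : ℕ}
    (h : N + 1 = n + r) :
    ((1 - p ^ 2)⁻¹ ^ r.choose 2 * ∏ i : Fin r, (p ^ 2) ^ (((i : ℕ) + 1 - r : ℝ) ^ 2 / 2)) *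
        ∑ K ∈ powersetCard r (range (N + 1)), absVandermonde (p ^ 2) K *
          ∏ k ∈ K, ((p ^ 2) ^ ((k : ℝ) ^ 2 / 2 + k * (1 - r : ℝ)) * DMM.qBinom (p ^ 2) N k) =
      qSumClosed p r n := by
  have hq : 0 < p ^ 2 := by positivity
  have hq1 : p ^ 2 < 1 := pow_lt_one₀ hp.le hp1 two_ne_zero
  have hpow : ∀ k : ℕ, 1 - p ^ (k + 1) ≠ 0 := fun k =>
    (sub_pos.2 (pow_lt_one₀ hp.le hp1 (by omega))).ne'
  have hsum := sum_absVandermonde hp hp1 n r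
  have hL : ∀ L : Finset ℕ, (p ^ 2) ^ ((∑ l ∈ L, (l : ℝ)) / 2) = ∏ l ∈ L, p ^ l := by
    intro L
    rw [← Real.rpow_natCast, ← Real.rpow_mul hp.le,
      prod_congr rfl fun l _ => (Real.rpow_natCast p l).symm, prod_pow_eq_rpow_sum hp]
    congr 1
    push_cast
    ring
  have hpn : ∏ j ∈ range n, p ^ j = (p ^ 2) ^ ((n : ℝ) * (n - 1) / 4) := by
    rw [prod_range_pow_eq_rpow hp, ← Real.rpow_natCast, ← Real.rpow_mul hp.le]
    congr 1
    push_cast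
    ring
  have hA : ∏ j ∈ range n, (1 - p ^ (2 * j + 1)) ≠ 0 := prod_ne_zero_iff.2 fun j _ => hpow _
  have hB : pairProd (fun i j => 1 - p ^ (2 * (i + j + 1))) (range n) ≠ 0 :=
    pairProd_ne_zero fun i _ j _ _ => hpow (2 * (i + j) + 1)
  have hC : ∏ k ∈ range (n + r), qEuler (p ^ 2) k ≠ 0 :=
    prod_ne_zero_iff.2 fun k _ => (qEuler_pos hq hq1 k).ne'
  rw [sum_subsets_qBinom hq hq1 h, h, prod_rpow_sq_div_two hq]
  simp only [hL]
  rw [eq_div_of_mul_eq (mul_ne_zero hA hB) hsum, hpn, absVandermonde_range hq hq1,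
    absVandermonde_range hq hq1]
  have hN : N = n + r - 1 := by omega
  -- All the explicit powers of `q` cancel against the one in `absVandermonde (p ^ 2) (range (n +
  -- r))`.
  have hexp : (p ^ 2) ^ ((r : ℝ) * (r - 1) * (2 * r - 1) / 12) *
      (p ^ 2) ^ ((n - 1 / 2) * ((N + 1) * N / 2 - n * N) + N * (n * (n - 1)) / 2 : ℝ) *
      (p ^ 2) ^ ((n : ℝ) * (n - 1) / 4) * (p ^ 2) ^ ((n : ℝ) * (n - 1) * (n - 2) / 6) =
      (p ^ 2) ^ (((n + r : ℕ) : ℝ) * ((n + r : ℕ) - 1) * ((n + r : ℕ) - 2) / 6) := by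
    have hN' : (N : ℝ) = n + r - 1 := by
      have : ((N + 1 : ℕ) : ℝ) = ((n + r : ℕ) : ℝ) := by rw [h]
      push_cast at this
      linarith
    rw [← Real.rpow_add hq, ← Real.rpow_add hq, ← Real.rpow_add hq]
    congr 1
    rw [hN']
    push_cast
    ring
  have h0 : (p ^ 2) ^ (((n + r : ℕ) : ℝ) * ((n + r : ℕ) - 1) * ((n + r : ℕ) - 2) / 6) ≠ 0 :=
    (Real.rpow_pos_of_pos hq _).ne'
  unfold qSumClosed
  rw [← hN]
  generalize (p ^ 2) ^ (((n + r : ℕ) : ℝ) * ((n + r : ℕ) - 1) * ((n + r : ℕ) - 2) / 6) = e0 at *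
  generalize (p ^ 2) ^ ((r : ℝ) * (r - 1) * (2 * r - 1) / 12) = e1 at *
  generalize (p ^ 2) ^ ((n - 1 / 2) * ((N + 1) * N / 2 - n * N) + N * (n * (n - 1)) / 2 : ℝ) = e2 at *
  generalize (p ^ 2) ^ ((n : ℝ) * (n - 1) / 4) = e3 at *
  generalize (p ^ 2) ^ ((n : ℝ) * (n - 1) * (n - 2) / 6) = e4 at *
  subst hexp
  generalize ∏ j ∈ range n, (1 - p ^ (2 * j + 1)) = A at *
  generalize pairProd (fun i j => 1 - p ^ (2 * (i + j + 1))) (range n) = B at *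
  generalize ∏ k ∈ range (n + r), qEuler (p ^ 2) k = C at *
  generalize (1 - p ^ 2)⁻¹ ^ r.choose 2 = D
  have g1 : e1 ≠ 0 := by rintro rfl; simp at h0
  have g2 : e2 ≠ 0 := by rintro rfl; simp at h0
  have g3 : e3 ≠ 0 := by rintro rfl; simp at h0
  have g4 : e4 ≠ 0 := by rintro rfl; simp at h0
  field_simp

theorem qsum_eq_factorial_mul_qSumClosed {p : ℝ} (hp : 0 < p) (hp1 : p < 1) {N n r : ℕ}
    (h : N + 1 = n + r) (x : ℝ) :
    ∑ κ : Fin r → Fin (N + 1),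
      (∏ i, ∏ j ∈ Ioi i, |DMM.qNum (p ^ 2) (((κ i : ℝ) - x) - ((κ j : ℝ) - x))|) *
        ∏ i, ((p ^ 2) ^ (((κ i : ℝ) - x + x - (r : ℝ) + ((i : ℕ) + 1 : ℝ)) ^ 2 / 2) *
            DMM.qBinom (p ^ 2) N (κ i)) = r.factorial * qSumClosed p r n := by
  have hq : 0 < p ^ 2 := by positivity
  have hq1 : p ^ 2 < 1 := pow_lt_one₀ hp.le hp1 two_ne_zero
  rw [sum_congr rfl fun κ _ => summand_symmetric hq hq1 r N x κ, ← mul_sum,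
    sum_tuple_eq_factorial_mul (N + 1) r (h := fun a b => |(p ^ 2) ^ a - (p ^ 2) ^ b|)
      (fun k : ℕ => (p ^ 2) ^ ((k : ℝ) ^ 2 / 2 + k * (1 - r : ℝ)) * DMM.qBinom (p ^ 2) N k)
      (fun a b => abs_sub_comm _ _) (fun a => by simp),
    ← sum_subsets_eq_qSumClosed hp hp1 h]
  unfold absVandermonde
  ring

/-! ### Products of gamma functions from the functional equation alone. -/

theorem prod_Icc_one_eq_prod_range (r : ℕ) (f : ℕ → ℝ) :
    ∏ i ∈ Icc 1 r, f i = ∏ i ∈ range r, f (i + 1) := by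
  induction r with
  | zero => simp
  | succ r ih => rw [prod_Icc_succ_top (by omega), ih, prod_range_succ]

theorem prod_Icc_one_reflect (r : ℕ) (f : ℕ → ℝ) :
    ∏ i ∈ Icc 1 r, f i = ∏ i ∈ range r, f (r - i) := by
  rw [prod_Icc_one_eq_prod_range, ← prod_range_reflect]
  refine prod_congr rfl fun i hi => ?_
  have := mem_range.1 hi
  congr 1
  omega

/-- The factor by which the product of gamma functions changes when `n` becomes `n + 1`. -/
noncomputable def gammaStep (c : ℝ → ℝ) (r n : ℕ) : ℝ :=
  ∏ i ∈ range r, c (n + r) * c (n + i + 3 / 2) / (c (n + i + 1) * c (n + (r + i) / 2 + 1))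

/-- The factor by which the product of gamma functions for `n = 0` changes when `r` becomes
`r + 1`. -/
noncomputable def gammaBaseStep (c : ℝ → ℝ) (r : ℕ) : ℝ :=
  c r ^ r * ∏ i ∈ range r, c (1 + i / 2) / c (i + 1)

/-- The product of gamma functions, with the function `c x = G (x + 1) / G x` only. -/
noncomputable def gammaProd (c : ℝ → ℝ) (r n : ℕ) : ℝ :=
  (∏ s ∈ range r, gammaBaseStep c s) * ∏ m ∈ range n, gammaStep c r m

section GammaProd

variable {G c : ℝ → ℝ} (hpos : ∀ x, 0 < x → 0 < G x) (hG : ∀ x, 0 < x → G (x + 1) = c x * G x)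
  (h1 : G 1 = 1)

include hpos hG in
theorem gammaProd_step (r n : ℕ) :
    ∏ i ∈ range r, (G (1 + (i + 1) / 2) / G (3 / 2) * (G ((n + 1 : ℕ) + r) * G ((n + 1 : ℕ) + i + 3 / 2) /
      (G ((n + 1 : ℕ) + i + 1) * G ((n + 1 : ℕ) + (r + i) / 2 + 1)))) =
    (∏ i ∈ range r, (G (1 + (i + 1) / 2) / G (3 / 2) * (G (n + r) * G (n + i + 3 / 2) /
      (G (n + i + 1) * G (n + (r + i) / 2 + 1))))) * gammaStep c r n := by
  unfold gammaStep
  rw [← prod_mul_distrib]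
  refine prod_congr rfl fun i hi => ?_
  have hr : (0 : ℝ) < r := by
    have := mem_range.1 hi
    exact_mod_cast (by omega : 0 < r)
  have e1 := hG (n + r) (by positivity)
  have e2 := hG (n + i + 3 / 2) (by positivity)
  have e3 := hG (n + i + 1) (by positivity)
  have e4 := hG (n + (r + i) / 2 + 1) (by positivity)
  have p3 := hpos (n + i + 1) (by positivity)
  have p4 := hpos (n + (r + i) / 2 + 1) (by positivity)
  have p3' := hpos (n + i + 1 + 1) (by positivity)
  have p4' := hpos (n + (r + i) / 2 + 1 + 1) (by positivity)
  have p5 := hpos (3 / 2) (by norm_num)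
  rw [e3] at p3'
  rw [e4] at p4'
  have c3 : c (n + i + 1) ≠ 0 := fun h => by simp [h] at p3'
  have c4 : c (n + (r + i) / 2 + 1) ≠ 0 := fun h => by simp [h] at p4'
  rw [show ((n + 1 : ℕ) + r : ℝ) = n + r + 1 by push_cast; ring,
    show ((n + 1 : ℕ) + i + 3 / 2 : ℝ) = n + i + 3 / 2 + 1 by push_cast; ring,
    show ((n + 1 : ℕ) + i + 1 : ℝ) = n + i + 1 + 1 by push_cast; ring,
    show ((n + 1 : ℕ) + (r + i) / 2 + 1 : ℝ) = n + (r + i) / 2 + 1 + 1 by push_cast; ring,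
    e1, e2, e3, e4]
  field_simp

include hpos hG h1 in
-- Arguments advancing by halves form two interleaved chains of unit steps, starting from `G 1` and
-- `G (3 / 2)`. This replaces the duplication formula.
theorem prod_gammaBaseStep_tail (r : ℕ) : G (1 + r / 2) * G ((r + 3) / 2) =
    G (3 / 2) * G (r + 1) * ∏ i ∈ range r, c (1 + i / 2) / c (i + 1) := by
  induction r with
  | zero => simp [h1]
  | succ r ih =>
    rw [prod_range_succ]
    have e1 := hG (1 + r / 2) (by positivity)
    have e2 := hG (r + 1) (by positivity)
    have p2 := hpos (r + 1 + 1) (by positivity)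
    rw [e2] at p2
    have c2 : c (r + 1) ≠ 0 := fun h => by simp [h] at p2
    rw [show (1 + (r + 1 : ℕ) / 2 : ℝ) = (r + 3) / 2 by push_cast; ring,
      show (((r + 1 : ℕ) + 3) / 2 : ℝ) = 1 + r / 2 + 1 by push_cast; ring,
      show ((r + 1 : ℕ) + 1 : ℝ) = r + 1 + 1 by push_cast; ring, e1, e2]
    have : G (3 / 2) * (c (r + 1) * G (r + 1)) * ((∏ i ∈ range r, c (1 + i / 2) / c (i + 1)) *
        (c (1 + r / 2) / c (r + 1))) =
      (G (3 / 2) * G (r + 1) * ∏ i ∈ range r, c (1 + i / 2) / c (i + 1)) * c (1 + r / 2) := by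
      field_simp
    rw [this, ← ih]
    ring

include hpos hG h1 in
theorem gammaProd_base (r : ℕ) :
    (∏ i ∈ range r, (G (1 + (i + 1) / 2) / G (3 / 2) * (G r * G (i + 3 / 2) /
      (G (i + 1) * G ((r + i) / 2 + 1))))) = ∏ s ∈ range r, gammaBaseStep c s := by
  -- Raising `r` by one shifts the window of half-integer spaced arguments: `1 + r / 2` leaves,
  -- while `r + 1` and `r + 3 / 2` enter.
  have hD : ∀ r : ℕ, (∏ i ∈ range (r + 1), G (((r + 1 : ℕ) + i) / 2 + 1)) * G (1 + r / 2) =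
      (∏ i ∈ range r, G ((r + i) / 2 + 1)) * (G (r + 1) * G (r + 3 / 2)) := by
    intro r
    have h2 := prod_range_succ (fun i : ℕ => G ((r + i) / 2 + 1)) (r + 1)
    rw [prod_range_succ', prod_range_succ (fun i : ℕ => G ((r + i) / 2 + 1)) r] at h2
    rw [show (1 + r / 2 : ℝ) = (r + (0 : ℕ)) / 2 + 1 by push_cast; ring,
      show (r + 1 : ℝ) = (r + r) / 2 + 1 by ring,
      show (r + 3 / 2 : ℝ) = (r + (r + 1 : ℕ)) / 2 + 1 by push_cast; ring,
      ← mul_assoc, ← h2]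
    congr 1
    refine prod_congr rfl fun i _ => ?_
    congr 1
    push_cast
    ring
  induction r with
  | zero => simp
  | succ r ih =>
    rw [prod_range_succ (gammaBaseStep c), ← ih]
    simp only [prod_mul_distrib, prod_div_distrib, prod_const, card_range]
    rw [prod_range_succ, prod_range_succ (fun i : ℕ => G (i + 3 / 2)),
      prod_range_succ (fun i : ℕ => G (i + 1))]
    have hD' := hD r
    have hW := prod_gammaBaseStep_tail hpos hG h1 r
    have q1 : ∏ i ∈ range (r + 1), G (((r + 1 : ℕ) + i) / 2 + 1) ≠ 0 :=
      (prod_pos fun i _ => hpos _ (by positivity)).ne'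
    have q2 : ∏ i ∈ range r, G ((r + i) / 2 + 1) ≠ 0 :=
      (prod_pos fun i _ => hpos _ (by positivity)).ne'
    have q3 : ∏ i ∈ range r, G (i + 1) ≠ 0 := (prod_pos fun i _ => hpos _ (by positivity)).ne'
    have q4 : G (3 / 2) ≠ 0 := (hpos _ (by norm_num)).ne'
    have q5 : G (r + 1) ≠ 0 := (hpos _ (by positivity)).ne'
    have q6 : G (r + 3 / 2) ≠ 0 := (hpos _ (by positivity)).ne'
    have q7 : G (1 + r / 2) ≠ 0 := (hpos _ (by positivity)).ne'
    -- At `r = 0` the functional equation is not available for the argument `r`, but the exponent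
    -- `r` makes the factors trivial.
    have hr : G ((r + 1 : ℕ)) ^ (r + 1) = G (r + 1) * (c r ^ r * G r ^ r) := by
      rw [← mul_pow]
      obtain _ | r := r
      · simp
      · rw [← hG _ (by positivity), pow_succ']
        push_cast
        rfl
    rw [hr, gammaBaseStep, eq_div_of_mul_eq q7 hD',
      show (1 + (r + 1) / 2 : ℝ) = (r + 3) / 2 by ring]
    have hW' : ∏ i ∈ range r, c (1 + i / 2) / c (i + 1) =
        G (1 + r / 2) * G ((r + 3) / 2) / (G (3 / 2) * G (r + 1)) := by
      rw [hW]; field_simp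
    rw [hW']
    generalize ∏ i ∈ range (r + 1), G (((r + 1 : ℕ) + i) / 2 + 1) = Q1 at *
    generalize ∏ i ∈ range r, G ((r + i) / 2 + 1) = Q2 at *
    generalize ∏ i ∈ range r, G (i + 1) = Q3 at *
    generalize G (3 / 2) = Q4 at *
    generalize G (r + 1) = Q5 at *
    generalize G (r + 3 / 2) = Q6 at *
    generalize G (1 + r / 2) = Q7 at *
    generalize G ((r + 3) / 2) = Q8
    generalize ∏ i ∈ range r, G (i + 3 / 2) = Q9
    generalize ∏ i ∈ range r, G (1 + (i + 1) / 2) = Q10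
    field_simp
    ring

include hpos hG h1 in
theorem prod_gamma_eq_gammaProd (r n : ℕ) (x : ℝ) (hx : x = n + r - 1) :
    ∏ i ∈ Icc 1 r, (G (1 + (i : ℝ) / 2) / G (3 / 2) * (G (x + 1) * G (x - (i : ℝ) + 5 / 2) /
      (G (x - (i : ℝ) + 2) * G (x - (i : ℝ) / 2 + 2)))) = gammaProd c r n := by
  have hrefl : ∏ i ∈ Icc 1 r, (G (1 + (i : ℝ) / 2) / G (3 / 2) *
      (G (x + 1) * G (x - (i : ℝ) + 5 / 2) / (G (x - (i : ℝ) + 2) * G (x - (i : ℝ) / 2 + 2)))) =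
      ∏ i ∈ range r, (G (1 + (i + 1) / 2) / G (3 / 2) * (G (n + r) * G (n + i + 3 / 2) /
        (G (n + i + 1) * G (n + (r + i) / 2 + 1)))) := by
    rw [prod_mul_distrib, prod_mul_distrib, prod_Icc_one_eq_prod_range, prod_Icc_one_reflect]
    congr 1
    · exact prod_congr rfl fun i _ => by push_cast; rfl
    · refine prod_congr rfl fun i hi => ?_
      rw [Nat.cast_sub (mem_range.1 hi).le, hx]
      congr 2
      · congr 1; ring
      · congr 1; ring
      · congr 1; ring
      · congr 1; ring
  rw [hrefl]
  clear hrefl hx x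
  unfold gammaProd
  induction n with
  | zero =>
    rw [range_zero, prod_empty, mul_one, ← gammaProd_base hpos hG h1]
    simp
  | succ n ih => rw [gammaProd_step hpos hG, ih, prod_range_succ, mul_assoc]

end GammaProd

/-! ### Matching the closed form with the prefactor and the gamma product. -/

theorem qNum_half {p : ℝ} (hp : 0 < p) (x : ℝ) (k : ℕ) (h : 2 * x = k) :
    DMM.qNum (p ^ 2) x = (1 - p ^ k) / (1 - p ^ 2) := by
  rw [DMM.qNum, ← Real.rpow_natCast p 2, ← Real.rpow_mul hp.le, Nat.cast_ofNat, h,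
    Real.rpow_natCast]

theorem qNum_natCast (q : ℝ) (k : ℕ) : DMM.qNum q k = (1 - q ^ k) / (1 - q) := by
  rw [DMM.qNum, Real.rpow_natCast]

/-- The prefactor of the `q`-sum, where `q = p ^ 2` and `N = n + r - 1`. -/
noncomputable def prefactor (p : ℝ) (r n : ℕ) : ℝ :=
  (∏ i ∈ range r, ((DMM.qPoch (-p) p (i + 1 : ℕ)) / (1 + p ^ (i + 1)))) / DMM.qFact p r *
    ∏ m ∈ range n, ∏ i ∈ range r, (1 + p ^ (2 * m + i + 1))

theorem qPoch_natCast_succ (a q : ℝ) (m : ℕ) :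
    DMM.qPoch a q (m + 1 : ℕ) = DMM.qPoch a q m * (1 - a * q ^ m) := by
  rw [← Int.ofNat_eq_natCast, ← Int.ofNat_eq_natCast, DMM.qPoch, DMM.qPoch, prod_range_succ]

theorem qPoch_zero (a q : ℝ) : DMM.qPoch a q (0 : ℕ) = 1 := by
  rw [← Int.ofNat_eq_natCast, DMM.qPoch]
  simp

theorem qPoch_natCast (a q : ℝ) (m : ℕ) :
    DMM.qPoch a q (m : ℕ) = ∏ k ∈ range m, (1 - a * q ^ k) := by
  rw [← Int.ofNat_eq_natCast, DMM.qPoch]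

/-- Extending the product downwards by the factor `1 + p ^ i` gives a uniform formula; for `n = 0`
it agrees with the convention for `(a;q)_{-1}`. -/
theorem qPoch_sub_one {p : ℝ} (hp : 0 < p) (i n : ℕ) :
    DMM.qPoch (-p ^ (i + 2)) (p ^ 2) ((n : ℤ) - 1) =
      (1 + p ^ i)⁻¹ * ∏ m ∈ range n, (1 + p ^ (2 * m + i)) := by
  obtain _ | n := n
  · rw [show ((0 : ℕ) : ℤ) - 1 = Int.negSucc 0 by rfl, DMM.qPoch]
    simp only [zero_add, prod_range_one, range_zero, prod_empty, mul_one, pow_one]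
    congr 1
    rw [pow_add, neg_div, mul_div_assoc, div_self (by positivity)]
    ring
  · rw [show ((n + 1 : ℕ) : ℤ) - 1 = Int.ofNat n by simp, DMM.qPoch, prod_range_succ']
    have : 1 + p ^ i ≠ 0 := by positivity
    rw [mul_comm (∏ _ ∈ _, _), mul_zero, zero_add, inv_mul_cancel_left₀ this]
    refine prod_congr rfl fun k _ => ?_
    rw [← pow_mul, neg_mul, ← pow_add, sub_neg_eq_add]
    congr 2
    ring

theorem prod_qPoch_div_qFact {p : ℝ} (hp : 0 < p) (r n : ℕ) :
    (∏ i ∈ Icc 1 r, (DMM.qPoch (-p) p (i : ℤ) *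
      DMM.qPoch (-p ^ (i + 2)) (p ^ 2) ((n : ℤ) - 1))) / DMM.qFact p r = prefactor p r n := by
  unfold prefactor
  rw [prod_comm, prod_Icc_one_eq_prod_range r fun i => (DMM.qPoch (-p) p (i : ℤ) *
      DMM.qPoch (-p ^ (i + 2)) (p ^ 2) ((n : ℤ) - 1)), div_mul_eq_mul_div, ← prod_mul_distrib]
  congr 1
  refine prod_congr rfl fun i _ => ?_
  rw [qPoch_sub_one hp, div_mul_eq_mul_div, mul_div_assoc, div_eq_inv_mul (∏ _ ∈ _, _)]
  rfl

theorem qFact_succ (q : ℝ) (r : ℕ) :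
    DMM.qFact q (r + 1) = DMM.qFact q r * DMM.qNum q ((r + 1 : ℕ) : ℝ) := by
  rw [DMM.qFact, DMM.qFact, prod_Icc_succ_top (by omega)]

/-- Telescopes: `1 - p ^ (2 (i + 1))` splits off `1 + p ^ (i + 1)`, which the shifted factorial
cancels, leaving the ratio of `1 - p ^ (i + 2)` to `1 - p ^ (i + 1)`. -/
theorem qPoch_mul_gammaBaseStep_tail {p : ℝ} (hp : 0 < p) (hp1 : p < 1) (r : ℕ) :
    DMM.qPoch (-p) p r * ∏ i ∈ range r, DMM.qNum (p ^ 2) (1 + i / 2) / DMM.qNum (p ^ 2) (i + 1) =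
      DMM.qNum p ((r + 1 : ℕ) : ℝ) := by
  have hpow : ∀ k : ℕ, 1 - p ^ (k + 1) ≠ 0 := fun k =>
    (sub_pos.2 (pow_lt_one₀ hp.le hp1 (by omega))).ne'
  have h1 : 1 - p ≠ 0 := by linarith
  induction r with
  | zero =>
    rw [qPoch_zero]
    simp [DMM.qNum, h1]
  | succ r ih =>
    rw [qPoch_natCast_succ, prod_range_succ, mul_mul_mul_comm, ih, qNum_natCast,
      qNum_natCast, qNum_half hp _ (r + 2) (by push_cast; ring),
      qNum_half hp _ (2 * (r + 1)) (by push_cast; ring)]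
    have h2 := hpow 1
    have h3 := hpow (2 * r + 1)
    have h4 := hpow r
    have e : 1 - p ^ (2 * (r + 1)) = (1 - p ^ (r + 1)) * (1 + p ^ (r + 1)) := by
      rw [mul_comm 2, pow_mul]; ring
    have h5 : 1 + p ^ (r + 1) ≠ 0 := by positivity
    rw [e, neg_mul, ← pow_succ', sub_neg_eq_add]
    simp only [Nat.reduceAdd] at h2
    generalize p ^ (r + 1 + 1) = x
    generalize p ^ (r + 1) = y at *
    field_simp

theorem qSumClosed_zero {p : ℝ} (hp : 0 < p) (hp1 : p < 1) (r : ℕ) :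
    qSumClosed p r 0 = prefactor p r 0 * gammaProd (DMM.qNum (p ^ 2)) r 0 := by
  have hq : 0 < p ^ 2 := by positivity
  have hq1 : p ^ 2 < 1 := pow_lt_one₀ hp.le hp1 two_ne_zero
  have hpow : ∀ k : ℕ, 1 - p ^ (k + 1) ≠ 0 := fun k =>
    (sub_pos.2 (pow_lt_one₀ hp.le hp1 (by omega))).ne'
  unfold qSumClosed prefactor gammaProd
  simp only [range_zero, prod_empty, pairProd_empty, mul_one, zero_add, div_one]
  induction r with
  | zero => simp [DMM.qFact]
  | succ r ih =>
    have hnum : DMM.qNum p ((r + 1 : ℕ) : ℝ) ≠ 0 := by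
      rw [DMM.qNum, Real.rpow_natCast]
      exact div_ne_zero (hpow r) (by linarith)
    have hc : DMM.qNum (p ^ 2) r ^ r = ((1 - p ^ 2)⁻¹ * (1 - (p ^ 2) ^ r)) ^ r := by
      rw [DMM.qNum, Real.rpow_natCast, div_eq_inv_mul]
    have hE : qEuler (p ^ 2) r ^ r = (qEuler (p ^ 2) (r - 1) * (1 - (p ^ 2) ^ r)) ^ r := by
      obtain _ | r := r
      · simp
      · rw [Nat.add_sub_cancel, qEuler_succ]
    have htail := qPoch_mul_gammaBaseStep_tail hp hp1 r
    rw [prod_range_succ, prod_range_succ, prod_range_succ (gammaBaseStep _), qFact_succ,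
      Nat.add_sub_cancel, pow_succ (qEuler _ _), hE, Nat.choose_succ_succ' r 1, Nat.choose_one_right, pow_add,
      qPoch_natCast_succ, gammaBaseStep, hc]
    have hEne := (qEuler_pos hq hq1 r).ne'
    have hone : 1 + p ^ (r + 1) ≠ 0 := by positivity
    have e : (1 - -p * p ^ r) / (1 + p ^ (r + 1)) = 1 := by
      rw [div_eq_one_iff_eq hone]; ring
    rw [mul_div_assoc _ (1 - -p * p ^ r), e, mul_one]
    have hEp : ∏ k ∈ range r, qEuler (p ^ 2) k ≠ 0 :=
      prod_ne_zero_iff.2 fun k _ => (qEuler_pos hq hq1 k).ne'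
    have hF : DMM.qFact p r ≠ 0 := prod_ne_zero_iff.2 fun k hk => by
      obtain ⟨j, rfl⟩ : ∃ j, k = j + 1 := ⟨k - 1, by have := mem_Icc.1 hk; omega⟩
      rw [DMM.qNum, Real.rpow_natCast]
      exact div_ne_zero (hpow j) (by linarith)
    have lhs : (1 - p ^ 2)⁻¹ ^ r * (1 - p ^ 2)⁻¹ ^ r.choose (1 + 1) *
        ((qEuler (p ^ 2) (r - 1) * (1 - (p ^ 2) ^ r)) ^ r * qEuler (p ^ 2) r) *
          (1 / ((∏ k ∈ range r, qEuler (p ^ 2) k) * qEuler (p ^ 2) r)) =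
        ((1 - p ^ 2)⁻¹ ^ r.choose 2 * qEuler (p ^ 2) (r - 1) ^ r *
          (1 / ∏ k ∈ range r, qEuler (p ^ 2) k)) * ((1 - p ^ 2)⁻¹ * (1 - (p ^ 2) ^ r)) ^ r := by
      rw [mul_pow, mul_pow]
      generalize (1 - p ^ 2)⁻¹ ^ r = u
      generalize (1 - p ^ 2)⁻¹ ^ r.choose 2 = v
      field_simp
    rw [lhs, ih]
    generalize DMM.qNum p ((r + 1 : ℕ) : ℝ) = X at *
    rw [← htail] at hnum ⊢
    generalize ∏ i ∈ range r, DMM.qNum (p ^ 2) (1 + i / 2) / DMM.qNum (p ^ 2) (i + 1) = W at *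
    have hP := left_ne_zero_of_mul hnum
    have hW := right_ne_zero_of_mul hnum
    generalize DMM.qPoch (-p) p r = P at *
    field_simp

theorem prod_range_mul_succ (e : ℕ → ℝ) (r : ℕ) :
    e 0 * ∏ j ∈ range r, (e (2 * j + 1) * e (2 * j + 2)) = ∏ k ∈ range (2 * r + 1), e k := by
  induction r with
  | zero => simp
  | succ r ih =>
    rw [prod_range_succ, ← mul_assoc, ih, show 2 * (r + 1) + 1 = 2 * r + 1 + 1 + 1 by ring,
      prod_range_succ _ (2 * r + 1 + 1), prod_range_succ _ (2 * r + 1)]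
    ring

theorem qSumClosed_succ {p : ℝ} (hp : 0 < p) (hp1 : p < 1) (r n : ℕ) :
    qSumClosed p r (n + 1) = qSumClosed p r n *
      ((∏ i ∈ range r, (1 + p ^ (2 * n + i + 1))) * gammaStep (DMM.qNum (p ^ 2)) r n) := by
  have hq : 0 < p ^ 2 := by positivity
  have hq1 : p ^ 2 < 1 := pow_lt_one₀ hp.le hp1 two_ne_zero
  have hpow : ∀ k : ℕ, 1 - p ^ (k + 1) ≠ 0 := fun k =>
    (sub_pos.2 (pow_lt_one₀ hp.le hp1 (by omega))).ne'
  have hEul : ∀ k, qEuler (p ^ 2) k ≠ 0 := fun k => (qEuler_pos hq hq1 k).ne'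
  have h1 : 1 - p ^ 2 ≠ 0 := hpow 1
  -- the step in terms of `e k = 1 - p ^ (2 n + 1 + k)`
  set e : ℕ → ℝ := fun k => 1 - p ^ (2 * n + 1 + k) with he
  have hene : ∀ k, e k ≠ 0 := fun k => by
    simp only [he]
    rw [add_right_comm]
    exact hpow _
  have hstep : (∏ i ∈ range r, (1 + p ^ (2 * n + i + 1))) * gammaStep (DMM.qNum (p ^ 2)) r n =
      ∏ i ∈ range r, ((1 - (p ^ 2) ^ (n + r)) * (1 - (p ^ 2) ^ (2 * n + i + 1)) * e (2 * i + 2) /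
        (e i * e (2 * i + 1) * e (r + 1 + i))) := by
    unfold gammaStep
    rw [← prod_mul_distrib]
    refine prod_congr rfl fun i _ => ?_
    rw [qNum_half hp _ (2 * (n + r)) (by push_cast; ring),
      qNum_half hp _ (2 * n + 1 + (2 * i + 2)) (by push_cast; ring),
      qNum_half hp _ (2 * n + 1 + (2 * i + 1)) (by push_cast; ring),
      qNum_half hp _ (2 * n + 1 + (r + 1 + i)) (by push_cast; ring)]
    have a1 := hene i
    have a2 := hene (2 * i + 1)
    have a3 := hene (r + 1 + i)
    have e1 : 1 - (p ^ 2) ^ (2 * n + i + 1) = e i * (1 + p ^ (2 * n + i + 1)) := by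
      simp only [he]
      rw [← pow_mul, mul_comm, pow_mul, add_right_comm (2 * n) 1 i]
      ring
    rw [e1, pow_mul]
    simp only [he] at a1 a2 a3 ⊢
    generalize p ^ (2 * n + 1 + (2 * i + 2)) = x1
    generalize 1 - p ^ (2 * n + 1 + (2 * i + 1)) = x2 at *
    generalize 1 - p ^ (2 * n + 1 + (r + 1 + i)) = x3 at *
    generalize 1 - p ^ (2 * n + 1 + i) = x4 at *
    generalize (p ^ 2) ^ (n + r) = x5
    generalize p ^ (2 * n + i + 1) = x6
    field_simp
  -- The product of `e 0, …, e (2 r)` is split in two ways: by parity of the index, and at the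
  -- middle index `r`. The comparison trades the even factors in `hstep` for the factors `e r` and
  -- `e 0` gained by the closed form.
  have hdouble := prod_range_mul_succ e r
  rw [two_mul, add_right_comm, prod_range_add, prod_range_succ, prod_mul_distrib] at hdouble
  have hodd : qEuler (p ^ 2) n * ∏ j ∈ range r, e (2 * j + 1) = qEuler (p ^ 2) (n + r) := by
    rw [qEuler_add]
    congr 1
    refine prod_congr rfl fun j _ => ?_
    simp only [he]
    rw [← pow_mul]
    congr 2
    ring
  have hlong : qEuler (p ^ 2) (2 * n) * ∏ i ∈ range r, (1 - (p ^ 2) ^ (2 * n + i + 1)) =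
      qEuler (p ^ 2) (2 * n + r) := (qEuler_add _ _ _).symm
  -- the change of the closed form
  have hE : qEuler (p ^ 2) (n + 1 + r - 1) ^ r =
      qEuler (p ^ 2) (n + r - 1) ^ r * (1 - (p ^ 2) ^ (n + r)) ^ r := by
    obtain _ | r := r
    · simp
    · rw [← mul_pow, show n + (r + 1) - 1 = n + r by omega,
        show n + 1 + (r + 1) - 1 = n + r + 1 by omega, qEuler_succ]
      rfl
  have hpp1 : pairProd (fun i j => 1 - p ^ (2 * (r + 1 + i + j))) (range (n + 1)) *
      qEuler (p ^ 2) (n + r) = qEuler (p ^ 2) (2 * n + r) *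
        pairProd (fun i j => 1 - p ^ (2 * (r + 1 + i + j))) (range n) := by
    rw [range_add_one, pairProd_insert (fun a b => by rw [add_right_comm]) notMem_range_self,
      show 2 * n + r = n + r + n by ring, qEuler_add _ (n + r) n]
    have : ∏ y ∈ range n, (1 - p ^ (2 * (r + 1 + n + y))) =
        ∏ i ∈ range n, (1 - (p ^ 2) ^ (n + r + i + 1)) := by
      refine prod_congr rfl fun y _ => ?_
      rw [← pow_mul]
      congr 2
      ring
    rw [this]
    ring
  have hpp2 : pairProd (fun i j => 1 - p ^ (2 * (i + j + 1))) (range (n + 1)) *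
      qEuler (p ^ 2) n = qEuler (p ^ 2) (2 * n) *
        pairProd (fun i j => 1 - p ^ (2 * (i + j + 1))) (range n) := by
    rw [range_add_one, pairProd_insert (fun a b => by rw [add_comm a b]) notMem_range_self,
      two_mul, qEuler_add]
    have : ∏ y ∈ range n, (1 - p ^ (2 * (n + y + 1))) =
        ∏ i ∈ range n, (1 - (p ^ 2) ^ (n + i + 1)) :=
      prod_congr rfl fun y _ => by rw [← pow_mul]
    rw [this]
    ring
  rw [hstep]
  unfold qSumClosed
  rw [hE, prod_range_succ _ n, prod_range_succ (fun j => 1 - p ^ (r + 1 + 2 * j)) n,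
    prod_range_succ (fun j => 1 - p ^ (2 * j + 1)) n, add_right_comm n 1 r, prod_range_succ _ (n + r),
    eq_div_of_mul_eq (hEul _) hpp1, eq_div_of_mul_eq (hEul _) hpp2, ← hlong]
  simp only [prod_mul_distrib, prod_div_distrib, prod_const, card_range]
  have g1 : (1 : ℝ) - p ^ (r + 1 + 2 * n) = e r := by
    simp only [he]; congr 2; ring
  have g2 : (1 : ℝ) - p ^ (2 * n + 1) = e 0 := rfl
  have z1 : ∏ j ∈ range r, e (2 * j + 1) ≠ 0 := prod_ne_zero_iff.2 fun _ _ => hene _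
  have z2 : ∏ j ∈ range r, e j ≠ 0 := prod_ne_zero_iff.2 fun _ _ => hene _
  have z3 : ∏ j ∈ range r, e (r + 1 + j) ≠ 0 := prod_ne_zero_iff.2 fun _ _ => hene _
  have z4 : ∏ k ∈ range (n + r), qEuler (p ^ 2) k ≠ 0 := prod_ne_zero_iff.2 fun _ _ => hEul _
  have z5 : ∏ j ∈ range n, (1 - p ^ (2 * j + 1)) ≠ 0 := prod_ne_zero_iff.2 fun _ _ => hpow _
  have z6 : pairProd (fun i j => 1 - p ^ (2 * (i + j + 1))) (range n) ≠ 0 :=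
    pairProd_ne_zero fun i _ j _ _ => hpow (2 * (i + j) + 1)
  have z7 := hene 0
  have z8 := hEul n
  have z9 := hEul (2 * n)
  have z10 : (∏ j ∈ range r, e (2 * j + 2)) = (∏ j ∈ range r, e j) * e r *
      (∏ j ∈ range r, e (r + 1 + j)) / (e 0 * ∏ j ∈ range r, e (2 * j + 1)) := by
    rw [eq_div_iff (mul_ne_zero z7 z1), ← hdouble]
    ring
  rw [g1, g2, z10, ← hodd]
  clear hstep hdouble hodd hlong hE hpp1 hpp2 z10 g1 g2
  generalize ∏ j ∈ range r, e (2 * j + 1) = v1 at *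
  generalize ∏ j ∈ range r, e j = v2 at *
  generalize ∏ j ∈ range r, e (r + 1 + j) = v3 at *
  generalize ∏ k ∈ range (n + r), qEuler (p ^ 2) k = v4 at *
  generalize ∏ j ∈ range n, (1 - p ^ (2 * j + 1)) = v5 at *
  generalize pairProd (fun i j => 1 - p ^ (2 * (i + j + 1))) (range n) = v6 at *
  generalize pairProd (fun i j => 1 - p ^ (2 * (r + 1 + i + j))) (range n) = v7 at *
  generalize qEuler (p ^ 2) n = v8 at *
  generalize qEuler (p ^ 2) (2 * n) = v9 at *
  generalize ∏ i ∈ range r, (1 - (p ^ 2) ^ (2 * n + i + 1)) = v10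
  generalize (1 - (p ^ 2) ^ (n + r)) ^ r = v11
  generalize qEuler (p ^ 2) (n + r - 1) ^ r = v12
  generalize (1 - p ^ 2)⁻¹ ^ r.choose 2 = v13
  generalize ∏ j ∈ range n, (1 - p ^ (r + 1 + 2 * j)) = v14
  generalize ∏ k ∈ range n, qEuler (p ^ 2) k = v15
  generalize e 0 = v16 at *
  generalize e r = v17 at *
  field_simp

theorem qSumClosed_eq {p : ℝ} (hp : 0 < p) (hp1 : p < 1) (r n : ℕ) :
    qSumClosed p r n = prefactor p r n * gammaProd (DMM.qNum (p ^ 2)) r n := by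
  induction n with
  | zero => exact qSumClosed_zero hp hp1 r
  | succ n ih =>
    rw [qSumClosed_succ hp hp1, ih, prefactor, prefactor, gammaProd, gammaProd,
      prod_range_succ _ n, prod_range_succ _ n]
    ring

/-! ### The `q`-gamma function and the case `0 < q < 1`. -/

open Filter Topology

section QGamma

variable {q : ℝ} (hq : 0 < q) (hq1 : q < 1)

include hq hq1 in
theorem summable_neg_mul_pow (a : ℝ) : Summable fun k : ℕ => -(a * q ^ k) :=
  ((summable_geometric_of_lt_one hq.le hq1).mul_left a).neg

include hq hq1 in
theorem qPochInf_eq (a : ℝ) : DMM.qPochInf a q = (1 - a) * DMM.qPochInf (a * q) q := by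
  have h := Real.multipliable_one_add_of_summable (summable_neg_mul_pow hq hq1 (a * q))
  unfold DMM.qPochInf
  rw [tprod_eq_zero_mul']
  · rw [pow_zero, mul_one]
    congr 1
    exact tprod_congr fun k => by ring
  · exact h.congr fun k => by ring

include hq hq1 in
-- Positivity of the factors alone would not exclude the limit `0`; the product is the exponential
-- of a convergent sum of logarithms.
theorem qPochInf_pos {a : ℝ} (ha : 0 < a) (ha1 : a < 1) : 0 < DMM.qPochInf a q := by
  have hpos : ∀ k : ℕ, 0 < 1 + -(a * q ^ k) := by
    intro k
    have h1 : q ^ k ≤ 1 := pow_le_one₀ hq.le hq1.le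
    have h2 : 0 < q ^ k := pow_pos hq k
    nlinarith
  have h := Real.rexp_tsum_eq_tprod hpos
    (Real.summable_log_one_add_of_summable (summable_neg_mul_pow hq hq1 a))
  have : DMM.qPochInf a q = ∏' k : ℕ, (1 + -(a * q ^ k)) :=
    tprod_congr fun k => by rw [sub_eq_add_neg]
  rw [this, ← h]
  exact Real.exp_pos _

include hq hq1 in
theorem qGamma_pos {x : ℝ} (hx : 0 < x) : 0 < DMM.qGamma q x :=
  mul_pos (Real.rpow_pos_of_pos (by linarith) _) (div_pos (qPochInf_pos hq hq1 hq hq1)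
    (qPochInf_pos hq hq1 (Real.rpow_pos_of_pos hq x) (Real.rpow_lt_one hq.le hq1 hx)))

include hq hq1 in
theorem qGamma_one : DMM.qGamma q 1 = 1 := by
  rw [DMM.qGamma, Real.rpow_one, sub_self, Real.rpow_zero, one_mul]
  exact div_self (qPochInf_pos hq hq1 hq hq1).ne'

include hq hq1 in
theorem qGamma_add_one {x : ℝ} (hx : 0 < x) :
    DMM.qGamma q (x + 1) = DMM.qNum q x * DMM.qGamma q x := by
  have hlt := Real.rpow_lt_one hq.le hq1 hx
  have h1 : 1 - q ^ x ≠ 0 := by linarith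
  have h2 : 1 - q ≠ 0 := by linarith
  have h3 : DMM.qPochInf (q ^ (x + 1)) q ≠ 0 := (qPochInf_pos hq hq1
    (Real.rpow_pos_of_pos hq _) (Real.rpow_lt_one hq.le hq1 (by linarith))).ne'
  rw [DMM.qGamma, DMM.qGamma, DMM.qNum, qPochInf_eq hq hq1 (q ^ x), ← Real.rpow_add_one hq.ne',
    show 1 - (x + 1) = 1 - x - 1 by ring, Real.rpow_sub_one h2]
  field_simp

end QGamma

theorem qsum_closed_form {q : ℝ} (hq : 0 < q) (hq1 : q < 1) {r N n : ℕ} (h : N + 1 = n + r)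
    {x : ℝ} (hx : 2 * x = N) :
    (∑ κ : Fin r → Fin (N + 1),
      (∏ i, ∏ j ∈ Ioi i, |DMM.qNum q (((κ i : ℝ) - x) - ((κ j : ℝ) - x))|) *
        ∏ i, (q ^ (((κ i : ℝ) - x + x - (r : ℝ) + ((i : ℕ) + 1 : ℝ)) ^ 2 / 2) *
          DMM.qBinom q N (κ i))) =
      ((r.factorial : ℝ) / DMM.qFact (q ^ (1 / 2 : ℝ)) r) *
        (∏ i ∈ Icc 1 r, (DMM.qPoch (-(q ^ (1 / 2 : ℝ))) (q ^ (1 / 2 : ℝ)) (i : ℤ) *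
          DMM.qPoch (-(q ^ ((i : ℝ) / 2 + 1))) q ((N : ℤ) - (r : ℤ)))) *
        ∏ i ∈ Icc 1 r, (DMM.qGamma q (1 + (i : ℝ) / 2) / DMM.qGamma q (3 / 2) *
          (DMM.qGamma q (2 * x + 1) * DMM.qGamma q (2 * x - (i : ℝ) + 5 / 2) /
            (DMM.qGamma q (2 * x - (i : ℝ) + 2) * DMM.qGamma q (2 * x - (i : ℝ) / 2 + 2)))) := by
  have hNr : (N : ℝ) = n + r - 1 := by
    have : ((N + 1 : ℕ) : ℝ) = ((n + r : ℕ) : ℝ) := by rw [h]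
    push_cast at this
    linarith
  rw [prod_gamma_eq_gammaProd (fun x hx => qGamma_pos hq hq1 hx)
    (fun x hx => qGamma_add_one hq hq1 hx) (qGamma_one hq hq1) r n (2 * x) (hx.trans hNr)]
  set p := q ^ (1 / 2 : ℝ) with hp_def
  have hp : 0 < p := Real.rpow_pos_of_pos hq _
  have hp1 : p < 1 := Real.rpow_lt_one hq.le hq1 (by norm_num)
  have hqp : q = p ^ 2 := by
    rw [hp_def, ← Real.rpow_natCast, ← Real.rpow_mul hq.le]
    norm_num
  have hexp : ∀ i : ℕ, q ^ ((i : ℝ) / 2 + 1) = p ^ (i + 2) := by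
    intro i
    rw [hp_def, ← Real.rpow_natCast, ← Real.rpow_mul hq.le]
    congr 1
    push_cast
    ring
  have hint : (N : ℤ) - (r : ℤ) = (n : ℤ) - 1 := by omega
  simp only [hexp, hint]
  clear_value p
  subst hqp
  rw [qsum_eq_factorial_mul_qSumClosed hp hp1 h, qSumClosed_eq hp hp1, ← prod_qPoch_div_qFact hp]
  ring

/-! ### The limit `q → 1`. -/

/-- `qNum q x` is the slope of `t ↦ t ^ x` between `1` and `q`, so its limit is the derivative at
`1`. -/
theorem tendsto_qNum (x : ℝ) : Tendsto (fun q => DMM.qNum q x) (𝓝[≠] 1) (𝓝 x) := by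
  have h := (Real.hasDerivAt_rpow_const (x := 1) (p := x) (Or.inl one_ne_zero))
  rw [hasDerivAt_iff_tendsto_slope, Real.one_rpow, mul_one] at h
  refine h.congr fun q => ?_
  rw [slope_def_field, Real.one_rpow, DMM.qNum, ← neg_sub (q ^ x), ← neg_sub q, neg_div_neg_eq]

theorem tendsto_sq_nhdsLT_one : Tendsto (fun p : ℝ => p ^ 2) (𝓝[<] 1) (𝓝[≠] 1) := by
  refine tendsto_nhdsWithin_iff.2 ⟨?_, ?_⟩
  · exact ((continuous_pow 2).tendsto' (1 : ℝ) 1 (one_pow 2)).mono_left nhdsWithin_le_nhds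
  · filter_upwards [self_mem_nhdsWithin, mem_nhdsWithin_of_mem_nhds (Ioi_mem_nhds zero_lt_one)]
      with p hp hp0
    exact (pow_lt_one₀ (le_of_lt hp0) hp two_ne_zero).ne

theorem tendsto_qNum_sq (x : ℝ) :
    Tendsto (fun p : ℝ => DMM.qNum (p ^ 2) x) (𝓝[<] 1) (𝓝 x) :=
  (tendsto_qNum x).comp tendsto_sq_nhdsLT_one

theorem tendsto_nhdsLT_one_of_continuous {f : ℝ → ℝ} (hf : Continuous f) {a : ℝ} (ha : f 1 = a) :
    Tendsto f (𝓝[<] 1) (𝓝 a) :=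
  (hf.tendsto' 1 a ha).mono_left nhdsWithin_le_nhds

theorem eventually_nhdsLT_one_mem_Ioo : ∀ᶠ p : ℝ in 𝓝[<] 1, 0 < p ∧ p < 1 := by
  filter_upwards [self_mem_nhdsWithin, mem_nhdsWithin_of_mem_nhds (Ioi_mem_nhds zero_lt_one)]
    with p hp hp0
  exact ⟨hp0, hp⟩

/-- Isolates the vanishing factor `(1 - q) ^ m`; in a `q`-binomial coefficient these powers cancel.
-/
theorem qEuler_eq_mul_prod_qNum {q : ℝ} (hq1 : q ≠ 1) (m : ℕ) :
    qEuler q m = (1 - q) ^ m * ∏ k ∈ range m, DMM.qNum q ((k + 1 : ℕ) : ℝ) := by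
  have h : 1 - q ≠ 0 := sub_ne_zero.2 hq1.symm
  have hc : (1 - q) ^ m = ∏ _k ∈ range m, (1 - q) := by simp
  rw [hc, ← prod_mul_distrib, qEuler]
  refine prod_congr rfl fun k _ => ?_
  rw [qNum_natCast, mul_div_cancel₀ _ h]

theorem tendsto_prod_qNum (m : ℕ) : Tendsto
    (fun p : ℝ => ∏ k ∈ range m, DMM.qNum (p ^ 2) ((k + 1 : ℕ) : ℝ)) (𝓝[<] 1)
      (𝓝 (m.factorial : ℝ)) := by
  rw [← prod_range_add_one_eq_factorial, Nat.cast_prod]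
  exact tendsto_finsetProd _ fun k _ => tendsto_qNum_sq _

theorem tendsto_qBinom {N k : ℕ} (hk : k ≤ N) :
    Tendsto (fun p : ℝ => DMM.qBinom (p ^ 2) N k) (𝓝[<] 1) (𝓝 (N.choose k : ℝ)) := by
  rw [Nat.cast_choose ℝ hk, mul_comm (k.factorial : ℝ)]
  refine ((tendsto_prod_qNum N).div ((tendsto_prod_qNum (N - k)).mul (tendsto_prod_qNum k))
    (by positivity)).congr' ?_
  filter_upwards [eventually_nhdsLT_one_mem_Ioo] with p ⟨hp, hp1⟩
  have hq1 : p ^ 2 < 1 := pow_lt_one₀ hp.le hp1 two_ne_zero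
  have h : (1 - p ^ 2) ^ N ≠ 0 := pow_ne_zero _ (by linarith)
  simp only [Pi.div_apply]
  rw [qBinom_eq (by positivity) hq1 hk, qEuler_eq_mul_prod_qNum hq1.ne,
    qEuler_eq_mul_prod_qNum hq1.ne, qEuler_eq_mul_prod_qNum hq1.ne, mul_mul_mul_comm, ← pow_add,
    Nat.sub_add_cancel hk, mul_div_mul_left _ _ h]

theorem tendsto_gammaProd (r n : ℕ) :
    Tendsto (fun p : ℝ => gammaProd (DMM.qNum (p ^ 2)) r n) (𝓝[<] 1)
      (𝓝 (gammaProd (fun x => x) r n)) := by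
  unfold gammaProd gammaBaseStep gammaStep
  refine Tendsto.mul (tendsto_finsetProd _ fun s _ => ?_) (tendsto_finsetProd _ fun m _ =>
    tendsto_finsetProd _ fun i _ => ?_)
  · exact ((tendsto_qNum_sq _).pow _).mul (tendsto_finsetProd _ fun i _ =>
      (tendsto_qNum_sq _).div (tendsto_qNum_sq _) (by positivity))
  · exact ((tendsto_qNum_sq _).mul (tendsto_qNum_sq _)).div
      ((tendsto_qNum_sq _).mul (tendsto_qNum_sq _)) (by positivity)

theorem tendsto_prefactor (r n : ℕ) :
    Tendsto (fun p : ℝ => prefactor p r n) (𝓝[<] 1)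
      (𝓝 (2 ^ r.choose 2 / r.factorial * 2 ^ (r * n))) := by
  have h1 : Tendsto (fun p : ℝ => DMM.qFact p r) (𝓝[<] 1) (𝓝 (r.factorial : ℝ)) := by
    have : (r.factorial : ℝ) = ∏ i ∈ Icc 1 r, (i : ℝ) := by
      rw [prod_Icc_one_eq_prod_range, ← prod_range_add_one_eq_factorial, Nat.cast_prod]
    rw [this]
    exact tendsto_finsetProd _ fun i _ =>
      (tendsto_qNum i).mono_left (nhdsWithin_mono _ fun x hx => ne_of_lt hx)
  have h2 : Tendsto (fun p : ℝ => ∏ m ∈ range n, ∏ i ∈ range r, (1 + p ^ (2 * m + i + 1))) (𝓝[<] 1)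
      (𝓝 (2 ^ (r * n))) := by
    refine tendsto_nhdsLT_one_of_continuous (by fun_prop) ?_
    simp only [one_pow, prod_const, card_range, ← pow_mul]
    norm_num
  have h3 : Tendsto (fun p : ℝ => ∏ i ∈ range r, DMM.qPoch (-p) p (i + 1 : ℕ) / (1 + p ^ (i + 1)))
      (𝓝[<] 1) (𝓝 (2 ^ r.choose 2)) := by
    have : (2 : ℝ) ^ r.choose 2 = ∏ i ∈ range r, 2 ^ (i + 1) / 2 := by
      clear h1 h2
      induction r with
      | zero => simp
      | succ r ih =>
        rw [prod_range_succ, ← ih, Nat.choose_succ_succ' r 1, Nat.choose_one_right]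
        ring
    rw [this]
    refine tendsto_finsetProd _ fun i _ => Tendsto.div ?_ ?_ two_ne_zero
    · simp only [qPoch_natCast]
      refine tendsto_nhdsLT_one_of_continuous (by fun_prop) ?_
      simp only [one_pow, mul_one, prod_const, card_range]
      norm_num
    · refine tendsto_nhdsLT_one_of_continuous (by fun_prop) ?_
      norm_num
  exact (h3.div h1 (by positivity)).mul h2

theorem tendsto_qsum (r N : ℕ) (x : ℝ) : Tendsto (fun p : ℝ =>
    ∑ κ : Fin r → Fin (N + 1),
      (∏ i, ∏ j ∈ Ioi i, |DMM.qNum (p ^ 2) (((κ i : ℝ) - x) - ((κ j : ℝ) - x))|) *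
        ∏ i, ((p ^ 2) ^ (((κ i : ℝ) - x + x - (r : ℝ) + ((i : ℕ) + 1 : ℝ)) ^ 2 / 2) *
            DMM.qBinom (p ^ 2) N (κ i))) (𝓝[<] 1)
    (𝓝 (∑ κ : Fin r → Fin (N + 1),
      (∏ i, ∏ j ∈ Ioi i, |((κ i : ℝ) - x) - ((κ j : ℝ) - x)|) *
        ∏ i, (Nat.choose N (κ i) : ℝ))) := by
  refine tendsto_finsetSum _ fun κ _ => Tendsto.mul (tendsto_finsetProd _ fun i _ =>
    tendsto_finsetProd _ fun j _ => (tendsto_qNum_sq _).abs) (tendsto_finsetProd _ fun i _ => ?_)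
  rw [← one_mul (Nat.choose N (κ i) : ℝ)]
  refine Tendsto.mul ?_ (tendsto_qBinom (Nat.lt_succ_iff.1 (κ i).2))
  have h := (Real.continuousAt_rpow_const 1 (((κ i : ℝ) - x + x - (r : ℝ) +
    ((i : ℕ) + 1 : ℝ)) ^ 2 / 2) (Or.inl one_ne_zero)).tendsto
  rw [Real.one_rpow] at h
  exact h.comp (tendsto_sq_nhdsLT_one.mono_right nhdsWithin_le_nhds)

theorem sum_closed_form {r N n : ℕ} (h : N + 1 = n + r) (x : ℝ) :
    ∑ κ : Fin r → Fin (N + 1), (∏ i, ∏ j ∈ Ioi i, |((κ i : ℝ) - x) - ((κ j : ℝ) - x)|) *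
        ∏ i, (Nat.choose N (κ i) : ℝ) =
      2 ^ (r.choose 2 + r * n) * gammaProd (fun x => x) r n := by
  have h1 := tendsto_qsum r N x
  have h2 := ((tendsto_prefactor r n).mul (tendsto_gammaProd r n)).const_mul (r.factorial : ℝ)
  have h3 := h2.congr' (f₂ := fun p : ℝ =>
    ∑ κ : Fin r → Fin (N + 1),
      (∏ i, ∏ j ∈ Ioi i, |DMM.qNum (p ^ 2) (((κ i : ℝ) - x) - ((κ j : ℝ) - x))|) *
        ∏ i, ((p ^ 2) ^ (((κ i : ℝ) - x + x - (r : ℝ) + ((i : ℕ) + 1 : ℝ)) ^ 2 / 2) *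
            DMM.qBinom (p ^ 2) N (κ i))) (by
    filter_upwards [eventually_nhdsLT_one_mem_Ioo] with p ⟨hp, hp1⟩
    rw [qsum_eq_factorial_mul_qSumClosed hp hp1 h, qSumClosed_eq hp hp1])
  rw [tendsto_nhds_unique h1 h3, pow_add]
  have : (r.factorial : ℝ) ≠ 0 := by positivity
  field_simp

theorem discreteMM_eq_sum (r : ℕ) {n : ℝ} {N : ℕ} (hN : 2 * n = N) :
    DMM.discreteMM r n 1 (1 / 2) 0 = ∑ κ : Fin r → Fin (N + 1),
      (∏ i, ∏ j ∈ Ioi i, |((κ i : ℝ) - n) - ((κ j : ℝ) - n)|) *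
        ∏ i, (Nat.choose N (κ i) : ℝ) := by
  have hfloor : ⌊2 * n⌋₊ = N := by rw [hN, Nat.floor_natCast]
  unfold DMM.discreteMM
  rw [hfloor]
  refine sum_congr rfl fun κ _ => ?_
  simp only [pow_one, Real.rpow_zero, one_mul, mul_one_div_cancel (two_ne_zero (α := ℝ)),
    Real.rpow_one, Finset.abs_prod]

end

theorem proposition5p1 (r : ℕ) (hr : 0 < r) (n : ℝ) (N : ℕ) (hN : 2 * n = (N : ℝ))
    (hn : ((r : ℝ) - 1) / 2 ≤ n) :
    -- the summation for `0 < q < 1`, where `k_i = κ_i - n` runs over `{-n, -n+1, …, n}`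
    (∀ q : ℝ, 0 < q → q < 1 →
      (∑ κ : Fin r → Fin (N + 1),
        let k : Fin r → ℝ := fun i => (κ i : ℝ) - n
        (∏ i, ∏ j ∈ Finset.Ioi i, |DMM.qNum q (k i - k j)|) *
          ∏ i, (q ^ ((k i + n - (r : ℝ) + ((i : ℕ) + 1 : ℝ)) ^ 2 / 2) *
            DMM.qBinom q N (κ i))) =
        ((r.factorial : ℝ) / DMM.qFact (q ^ (1 / 2 : ℝ)) r) *
          (∏ i ∈ Finset.Icc 1 r,
            (DMM.qPoch (-(q ^ (1 / 2 : ℝ))) (q ^ (1 / 2 : ℝ)) (i : ℤ) *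
              DMM.qPoch (-(q ^ ((i : ℝ) / 2 + 1))) q ((N : ℤ) - (r : ℤ)))) *
          ∏ i ∈ Finset.Icc 1 r,
            (DMM.qGamma q (1 + (i : ℝ) / 2) / DMM.qGamma q (3 / 2) *
              (DMM.qGamma q (2 * n + 1) * DMM.qGamma q (2 * n - (i : ℝ) + 5 / 2) /
                (DMM.qGamma q (2 * n - (i : ℝ) + 2) *
                  DMM.qGamma q (2 * n - (i : ℝ) / 2 + 2))))) ∧
    -- the case `q = 1`
    DMM.discreteMM r n 1 (1 / 2) 0 =
      (∑ κ : Fin r → Fin (N + 1),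
        let k : Fin r → ℝ := fun i => (κ i : ℝ) - n
        (∏ i, ∏ j ∈ Finset.Ioi i, |k i - k j|) * ∏ i, (Nat.choose N (κ i) : ℝ)) ∧
    DMM.discreteMM r n 1 (1 / 2) 0 =
      (2 : ℝ) ^ (2 * (r : ℝ) * n - (r.choose 2 : ℝ)) *
        ∏ i ∈ Finset.Icc 1 r,
          (Real.Gamma (1 + (i : ℝ) / 2) / Real.Gamma (3 / 2) *
            (Real.Gamma (2 * n + 1) * Real.Gamma (2 * n - (i : ℝ) + 5 / 2) /
              (Real.Gamma (2 * n - (i : ℝ) + 2) *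
                Real.Gamma (2 * n - (i : ℝ) / 2 + 2)))) := by
  -- This is the lower bound on `n`: it makes the complementary size `m = N + 1 - r` a natural
  -- number.
  have hNr : r ≤ N + 1 := by
    have : (r : ℝ) ≤ ((N + 1 : ℕ) : ℝ) := by push_cast; linarith
    exact_mod_cast this
  obtain ⟨m, hm⟩ : ∃ m, N + 1 = m + r := ⟨N + 1 - r, by omega⟩
  have hsum := discreteMM_eq_sum r hN
  refine ⟨fun q hq hq1 => qsum_closed_form hq hq1 hm hN, hsum, ?_⟩
  have hNm : 2 * n = m + r - 1 := by
    have : ((N + 1 : ℕ) : ℝ) = ((m + r : ℕ) : ℝ) := by rw [hm]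
    push_cast at this
    linarith
  rw [hsum, sum_closed_form hm, prod_gamma_eq_gammaProd (c := fun x => x)
    (fun x hx => Real.Gamma_pos_of_pos hx) (fun x hx => Real.Gamma_add_one hx.ne')
    Real.Gamma_one r m (2 * n) hNm, ← Real.rpow_natCast]
  -- With `2 n = m + r - 1`, the exponent `2 r n - r (r - 1) / 2` equals `r m + r (r - 1) / 2`.
  congr 2
  rw [show 2 * (r : ℝ) * n = r * (2 * n) by ring, hNm]
  push_cast [Nat.cast_choose_two]
  ring
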